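/- Let $\mathcal H$ be a complex Hilbert space, $\mathcal B(\mathcal H)$ the bounded operators, $\mathcal U(\mathcal H)$ the unitary group, $\mathcal B_h(\mathcal H)$ and $\mathcal B_{ah}(\mathcal H)$ the real Banach spaces of Hermitian and anti-Hermitian operators, and let $$\mathcal R=\{(P,f)\in\mathcal B(\mathcal H)\times\mathcal H:\ P=P^*=P^2,\ Pf=f,\ \|f\|=1\}.$$ For an orthogonal projection $P_0$ let $\mathcal R_{P_0}$ be the set of $(P,f)\in\mathcal R$ such that $P=UP_0U^*$ for some $U\in\mathcal U(\mathcal H)$. Submanifolds of (real) Banach spaces are embedded, with closed complemented tangent spaces; submersions have complemented kernels, i.e. in suitable charts they are projections $(u,v)\mapsto u$. (1) $\mathcal R$ is a real-analytic (in particular $C^\infty$) submanifold of $\mathcal B(\mathcal H)\times\mathcal H$. (2) $\mathcal U(\mathcal H)$ is a real-analytic submanifold of $\mathcal B(\mathcal H)$ modelled on $\mathcal B_{ah}(\mathcal H)$ and, for every $(P_0,f_0)\in\mathcal R$, $\mathcal R_{P_0}$ is a real-analytic submanifold of $\mathcal B(\mathcal H)\times\mathcal H$; with respect to these structures the orbit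 map $$\rho_{(P_0,f_0)}:\mathcal U(\mathcal H)\to\mathcal R_{P_0},\qquad \rho_{(P_0,f_0)}(U)=(UP_0U^*,Uf_0),$$ is a real-analytic (in particular $C^\infty$) submersion. (3) For every $(P_0,f_0)\in\mathcal R$, the tangent space at $(P_0,f_0)$ of $\mathcal R$, and also of $\mathcal R_{P_0}$, is $$T_{(P_0,f_0)}=\{(XP_0-P_0X,\,Xf_0):\ X\in\mathcal B(\mathcal H),\ X^*=-X\};$$ this real subspace is complemented in $\mathcal B(\mathcal H)\times\mathcal H$, and, writing $P_0^\perp=1-P_0$ and $f_0\otimes f_0=\langle\,\cdot\,,f_0\rangle f_0$ (inner product linear in the first variable), the formula $$\mathcal E(X,h)=\bigl(P_0^\perp XP_0+P_0XP_0^\perp,\ i\,\mathrm{Im}\langle h,f_0\rangle f_0+(P_0-f_0\otimes f_0)h+P_0^\perp Xf_0\bigr)$$ defines a continuous real-linear map $\mathcal E:\mathcal B_h(\mathcal H)\times\mathcal H\to\mathcal B_h(\mathcal H)\times\mathcal H$ with $\mathcal E^2=\mathcal E$ and range $T_{(P_0,f_0)}$. -/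

import Mathlib

open scoped Manifold ContDiff

/-- `S` is a (split, embedded) submanifold of class `C^n` of the real Banach space `E`: around every
point of `S` there is a `C^n` diffeomorphism `φ` between open subsets of `E` which straightens `S`
onto a closed complemented linear subspace. For `n = ω` this means real analytic. The subspace may
depend on the point, so that different components may be modelled on different spaces. -/
def IsBanachSubmanifold {E : Type*} [NormedAddCommGroup E] [NormedSpace ℝ E]
    (n : WithTop ℕ∞) (S : Set E) : Prop :=
  ∀ x ∈ S, ∃ (V : Submodule ℝ E) (φ : OpenPartialHomeomorph E E),
    V.ClosedComplemented ∧ x ∈ φ.source ∧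
    ContDiffOn ℝ n φ φ.source ∧ ContDiffOn ℝ n φ.symm φ.target ∧
    ∀ y ∈ φ.source, y ∈ S ↔ φ y ∈ V

/-- The tangent space at `x` of a subset `S` of `E`: the velocities at `x` of the smooth curves
that pass through `x` and stay in `S`. -/
def tangentSet {E : Type*} [NormedAddCommGroup E] [NormedSpace ℝ E] (S : Set E) (x : E) : Set E :=
  {v | ∃ γ : ℝ → E, ContDiffAt ℝ ∞ γ 0 ∧ γ 0 = x ∧ (∀ᶠ t in nhds 0, γ t ∈ S) ∧
    HasDerivAt γ v 0}

/-- An atlas on a space `M` (with model `V`) is a real analytic submanifold structure with respect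
to the inclusion `i : M → E` if `M` is a real analytic manifold and `i` is a real analytic
embedding. Such a structure is determined by `i` up to the choice of the model space. -/
def IsAnalyticSubmanifoldStructure {V E M : Type*} [NormedAddCommGroup V] [NormedSpace ℝ V]
    [NormedAddCommGroup E] [NormedSpace ℝ E] [TopologicalSpace M]
    (c : ChartedSpace V M) (i : M → E) : Prop :=
  IsManifold 𝓘(ℝ, V) ω M ∧ Manifold.IsSmoothEmbedding 𝓘(ℝ, V) 𝓘(ℝ, E) ω i

section SphereBundle

variable {H : Type*} [NormedAddCommGroup H] [InnerProductSpace ℂ H] [CompleteSpace H]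

variable (H) in
/-- The total space `R` of the canonical sphere bundle over the Grassmann manifold of `H`. -/
def sphereBundle : Set ((H →L[ℂ] H) × H) :=
  {p | IsStarProjection p.1 ∧ p.1 p.2 = p.2 ∧ ‖p.2‖ = 1}

/-- `R_{P₀}`: the pairs `(P, f)` in `R` with `P` unitarily equivalent to `P₀`. -/
def sphereBundleOver (P₀ : H →L[ℂ] H) : Set ((H →L[ℂ] H) × H) :=
  {p | p ∈ sphereBundle H ∧ ∃ U ∈ unitary (H →L[ℂ] H), U * P₀ * star U = p.1}

theorem orbit_mem {P₀ : H →L[ℂ] H} {f₀ : H} (h : (P₀, f₀) ∈ sphereBundle H)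
    (U : unitary (H →L[ℂ] H)) :
    ((U : H →L[ℂ] H) * P₀ * star (U : H →L[ℂ] H), (U : H →L[ℂ] H) f₀) ∈ sphereBundleOver P₀ := by
  obtain ⟨⟨hi, hs⟩, hf, hn⟩ := h
  have hU : star (U : H →L[ℂ] H) * (U : H →L[ℂ] H) = 1 := (Unitary.mem_iff.1 U.2).1
  have hi' : P₀ * P₀ = P₀ := hi
  have hs' : star P₀ = P₀ := hs
  have happ : ∀ x : H, star (U : H →L[ℂ] H) ((U : H →L[ℂ] H) x) = x := fun x => by
    rw [← mul_apply_eq_comp, hU]; rfl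
  refine ⟨⟨⟨?_, ?_⟩, ?_, ?_⟩, U, U.2, rfl⟩
  · change (U : H →L[ℂ] H) * P₀ * star (U : H →L[ℂ] H) *
      ((U : H →L[ℂ] H) * P₀ * star (U : H →L[ℂ] H)) = _
    calc _ = (U : H →L[ℂ] H) * P₀ * (star (U : H →L[ℂ] H) * (U : H →L[ℂ] H)) * P₀ *
          star (U : H →L[ℂ] H) := by noncomm_ring
      _ = (U : H →L[ℂ] H) * (P₀ * P₀) * star (U : H →L[ℂ] H) := by rw [hU]; noncomm_ring
      _ = _ := by rw [hi']
  · change star ((U : H →L[ℂ] H) * P₀ * star (U : H →L[ℂ] H)) = _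
    simp [hs', mul_assoc]
  · change (U : H →L[ℂ] H) (P₀ (star (U : H →L[ℂ] H) ((U : H →L[ℂ] H) f₀))) = _
    rw [happ, hf]
  · change ‖(U : H →L[ℂ] H) f₀‖ = 1
    have h2 : ‖(U : H →L[ℂ] H) f₀‖ ^ 2 = ‖f₀‖ ^ 2 := by
      have h3 := inner_self_eq_norm_sq (𝕜 := ℂ) ((U : H →L[ℂ] H) f₀)
      rw [← ContinuousLinearMap.adjoint_inner_right, ← ContinuousLinearMap.star_eq_adjoint, happ,
        inner_self_eq_norm_sq] at h3
      exact h3.symm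
    rw [sq_eq_sq₀ (norm_nonneg _) (norm_nonneg _)] at h2
    exact h2.trans hn

/-- The orbit map `ρ : U(H) → R_{P₀}`, `ρ(U) = (U P₀ U*, U f₀)`. -/
noncomputable def orbitMap {P₀ : H →L[ℂ] H} {f₀ : H} (h : (P₀, f₀) ∈ sphereBundle H)
    (U : unitary (H →L[ℂ] H)) : sphereBundleOver P₀ :=
  ⟨((U : H →L[ℂ] H) * P₀ * star (U : H →L[ℂ] H), (U : H →L[ℂ] H) f₀), orbit_mem h U⟩

/-- The real linear subspace `{(X P₀ - P₀ X, X f₀) : X* = -X}` of `B(H) × H`. -/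
noncomputable def orbitTangent (P₀ : H →L[ℂ] H) (f₀ : H) : Submodule ℝ ((H →L[ℂ] H) × H) where
  carrier := {v | ∃ X : H →L[ℂ] H, star X = -X ∧ v = (X * P₀ - P₀ * X, X f₀)}
  zero_mem' := ⟨0, by simp, by ext1 <;> simp⟩
  add_mem' := by
    rintro _ _ ⟨X, hX, rfl⟩ ⟨Y, hY, rfl⟩
    refine ⟨X + Y, by rw [star_add, hX, hY]; abel, ?_⟩
    ext1
    · simp only [Prod.fst_add]; noncomm_ring
    · simp
  smul_mem' := by
    rintro c _ ⟨X, hX, rfl⟩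
    refine ⟨c • X, by simp [hX], ?_⟩
    ext1
    · simp [smul_sub]
    · simp

/-- The formula
`(X, h) ↦ (P₀^⊥ X P₀ + P₀ X P₀^⊥, i Im⟨h, f₀⟩ f₀ + (P₀ - f₀ ⊗ f₀) h + P₀^⊥ X f₀)`, where
`P₀^⊥ = 1 - P₀`, `(x ⊗ y) z = ⟨z, y⟩ x` and `⟨h, f₀⟩` is linear in `h` (Mathlib's inner product
is linear in the second variable). -/
noncomputable def tangentProjFormula (P₀ : H →L[ℂ] H) (f₀ : H) (X : H →L[ℂ] H) (h : H) :
    (H →L[ℂ] H) × H :=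
  ((1 - P₀) * X * P₀ + P₀ * X * (1 - P₀),
    (Complex.I * ((inner ℂ f₀ h).im : ℂ)) • f₀ + (P₀ h - inner ℂ f₀ h • f₀) + (1 - P₀) (X f₀))

end SphereBundle

/-! Write `U · (P, f) = (U P U*, U f)`. At `p = (P, f)` in the sphere bundle, the derivative of the
action at `1` is `D X = (XP - PX, Xf)`, and `T = D(anti-Hermitian)` is `orbitTangent P f`. An
explicit real-linear map `s` (`orbitSection`), which sees only the Hermitian part of the operator
component, takes anti-Hermitian values and satisfies `D s = id` on `T`. Hence `π = D s`
(`tangentProj`) is a continuous projection onto `T`, and on Hermitian first components it is the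
formula for `𝓔` (`orbitDeriv_orbitLift`).

The map `Φ(v) = exp(s v) · (p + (v - π v))` (`orbitParam`) is analytic with derivative `id` at `0`.
It sends `T` into the orbit of `p`. Conversely, if `Φ(v)` lies in the bundle, then so does `p + c`
with `c = v - π v ∈ ker π`, by unitary invariance; for `‖c‖ < 1` this forces `c = 0`
(`eq_zero_of_tangentProj_eq_zero`). So the local inverse of `Φ` straightens both the bundle and
`sphereBundleOver P` onto `T`. The latter is a single orbit (`exists_conjEquiv_eq`), so unitary
translates of this chart cover it.

Near `1` the unitaries are parametrized by `X ↦ exp(k X) exp(X - k X)` with `X` anti-Hermitian and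
`k = s D`. Since `D(X - k X) = 0`, the second factor fixes `p`, and in these coordinates the orbit
map is exactly the linear map `D`, which is split by `s`. Translation carries this to every unitary.
-/

open Set Topology

/-! ### Slice charts and the analytic inverse function theorem -/

/-- A chart `φ` of a real Banach space, analytic in both directions, which straightens `S` onto the
linear subspace `V`. -/
structure IsSliceChart {E : Type*} [NormedAddCommGroup E] [NormedSpace ℝ E]
    (S : Set E) (V : Submodule ℝ E) (φ : OpenPartialHomeomorph E E) : Prop where
  contDiffOn : ContDiffOn ℝ ω φ φ.source
  contDiffOn_symm : ContDiffOn ℝ ω φ.symm φ.target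
  mem_iff : ∀ y ∈ φ.source, y ∈ S ↔ φ y ∈ V

/-- The analytic inverse function theorem at a point where the derivative is the identity. -/
theorem exists_openPartialHomeomorph_of_hasFDerivAt_id {E : Type*} [NormedAddCommGroup E]
    [NormedSpace ℝ E] [CompleteSpace E] {Φ : E → E} {a : E} (hΦ : ContDiffAt ℝ ω Φ a)
    (hd : HasFDerivAt Φ (ContinuousLinearMap.id ℝ E) a) {N : Set E} (hN : N ∈ 𝓝 a) :
    ∃ ψ : OpenPartialHomeomorph E E, a ∈ ψ.source ∧ ψ.source ⊆ N ∧ (∀ x, ψ x = Φ x) ∧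
      ContDiffOn ℝ ω ψ ψ.source ∧ ContDiffOn ℝ ω ψ.symm ψ.target := by
  have hd' : HasFDerivAt Φ ((ContinuousLinearEquiv.refl ℝ E : E ≃L[ℝ] E) : E →L[ℝ] E) a := hd
  have hω : (ω : WithTop ℕ∞) ≠ 0 := by simp
  have hω' : (ω : WithTop ℕ∞) ≠ ∞ := by simp
  let e₀ := hΦ.toOpenPartialHomeomorph Φ hd' hω
  -- Shrink to the points where the map and its inverse are both analytic. This locus is open
  -- because the smoothness exponent is not `∞`.
  let e := e₀.restrContDiff ℝ ω hω'
  have hae : a ∈ e.source := by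
    refine ⟨hΦ.mem_toOpenPartialHomeomorph_source hd' hω, hΦ, ?_⟩
    exact hΦ.to_localInverse hd' hω
  obtain ⟨u, huN, hu, hau⟩ := mem_nhds_iff.1 hN
  refine ⟨e.restrOpen u hu, ⟨hae, hau⟩, fun x hx => huN hx.2, fun x => rfl, ?_, ?_⟩
  · exact (e₀.contDiffOn_restrContDiff_source ℝ hω').mono fun x hx => hx.1
  · exact (e₀.contDiffOn_restrContDiff_target ℝ hω').mono fun x hx => hx.1

/-! ### Manifold structures, immersions and submersions from slice charts -/

namespace IsSliceChart

variable {E : Type*} [NormedAddCommGroup E] [NormedSpace ℝ E]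
variable {S : Set E} {V : Submodule ℝ E} {φ φ' : OpenPartialHomeomorph E E}

/-- Lets a chart at one base point be carried to other points by linear symmetries of `S`. -/
theorem comp_equiv (hφ : IsSliceChart S V φ) (L : E ≃L[ℝ] E) (hL : ∀ y, L y ∈ S ↔ y ∈ S) :
    IsSliceChart S V (L.toHomeomorph.transOpenPartialHomeomorph φ) where
  contDiffOn := hφ.contDiffOn.comp L.contDiff.contDiffOn fun _ hx => hx
  contDiffOn_symm := L.symm.contDiff.comp_contDiffOn hφ.contDiffOn_symm
  mem_iff y hy := (hL y).symm.trans (hφ.mem_iff (L y) hy)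

theorem mem_maximalAtlas (hφ : IsSliceChart S V φ) :
    φ ∈ IsManifold.maximalAtlas 𝓘(ℝ, E) ω E := by
  rw [IsManifold.mem_maximalAtlas_iff_contMDiffOn]
  exact ⟨hφ.contDiffOn.contMDiffOn, hφ.contDiffOn_symm.contMDiffOn⟩

variable {M : Type*} {i : M → E}

theorem exists_of_mem_target (hφ : IsSliceChart (range i) V φ) {v : V}
    (hv : (v : E) ∈ φ.target) : ∃ m, i m = φ.symm v := by
  have := (hφ.mem_iff _ (φ.map_target hv)).2 (by rw [φ.right_inv hv]; exact v.2)
  exact this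

variable [TopologicalSpace M] [Nonempty M]

/-- The chart which a slice chart induces on an embedded space. -/
noncomputable def chart (hi : IsEmbedding i) (p : E →L[ℝ] V) (hp : ∀ v : V, p v = v)
    (hφ : IsSliceChart (range i) V φ) : OpenPartialHomeomorph M V where
  -- On the source `φ (i m)` already lies in `V`, so `p` only changes the codomain. Likewise
  -- `Function.invFun` takes a junk value only off the range of `i`, which `φ.symm v` never leaves
  -- for `v` in the target.
  toFun m := p (φ (i m))
  invFun v := Function.invFun i (φ.symm v)
  source := i ⁻¹' φ.source
  target := Subtype.val ⁻¹' φ.target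
  map_source' m hm := by
    have h : φ (i m) ∈ V := (hφ.mem_iff _ hm).1 ⟨m, rfl⟩
    change ((p (φ (i m)) : V) : E) ∈ φ.target
    rw [show p (φ (i m)) = ⟨_, h⟩ from hp ⟨_, h⟩]
    exact φ.map_source hm
  map_target' v hv := by
    change i (Function.invFun i (φ.symm v)) ∈ φ.source
    rw [Function.invFun_eq (hφ.exists_of_mem_target hv)]
    exact φ.map_target hv
  left_inv' m hm := by
    have h : φ (i m) ∈ V := (hφ.mem_iff _ hm).1 ⟨m, rfl⟩
    rw [show p (φ (i m)) = ⟨_, h⟩ from hp ⟨_, h⟩]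
    change Function.invFun i (φ.symm (φ (i m))) = m
    rw [φ.left_inv hm, Function.leftInverse_invFun hi.injective]
  right_inv' v hv := by
    rw [Function.invFun_eq (hφ.exists_of_mem_target hv), φ.right_inv hv, hp]
  open_source := φ.open_source.preimage hi.continuous
  open_target := φ.open_target.preimage continuous_subtype_val
  continuousOn_toFun := p.continuous.comp_continuousOn
    (φ.continuousOn.comp hi.continuous.continuousOn fun _ h => h)
  continuousOn_invFun := by
    rw [hi.continuousOn_iff]
    refine (φ.continuousOn_symm.comp continuous_subtype_val.continuousOn
      fun _ h => h).congr fun v hv => ?_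
    exact Function.invFun_eq (hφ.exists_of_mem_target hv)

variable (hi : IsEmbedding i) (p : E →L[ℝ] V) (hp : ∀ v : V, p v = v)

theorem map_chart_symm (hφ : IsSliceChart (range i) V φ) {v : V} (hv : (v : E) ∈ φ.target) :
    i ((hφ.chart hi p hp).symm v) = φ.symm v :=
  Function.invFun_eq (hφ.exists_of_mem_target hv)

theorem contDiffOn_chart_trans (hφ : IsSliceChart (range i) V φ)
    (hφ' : IsSliceChart (range i) V φ') :
    ContDiffOn ℝ ω ((hφ.chart hi p hp).symm ≫ₕ hφ'.chart hi p hp)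
      ((hφ.chart hi p hp).symm ≫ₕ hφ'.chart hi p hp).source := by
  have hs : ∀ v ∈ ((hφ.chart hi p hp).symm ≫ₕ hφ'.chart hi p hp).source,
      (v : E) ∈ φ.target ∧ φ.symm v ∈ φ'.source := by
    intro v hv
    have h1 : (v : E) ∈ φ.target := hv.1
    have h2 : i ((hφ.chart hi p hp).symm v) ∈ φ'.source := hv.2
    rw [hφ.map_chart_symm hi p hp h1] at h2
    exact ⟨h1, h2⟩
  have : ContDiffOn ℝ ω (fun v : V => p (φ' (φ.symm v)))
      ((hφ.chart hi p hp).symm ≫ₕ hφ'.chart hi p hp).source :=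
    p.contDiff.comp_contDiffOn (hφ'.contDiffOn.comp
      (hφ.contDiffOn_symm.comp V.subtypeL.contDiff.contDiffOn fun v hv => (hs v hv).1)
      fun v hv => (hs v hv).2)
  refine this.congr fun v hv => ?_
  change p (φ' (i ((hφ.chart hi p hp).symm v))) = _
  rw [hφ.map_chart_symm hi p hp (hs v hv).1]

/-- The structure of a manifold on an embedded space given by all slice charts. -/
@[reducible]
noncomputable def chartedSpace (H : ∀ m, ∃ φ, IsSliceChart (range i) V φ ∧ i m ∈ φ.source) :
    ChartedSpace V M where
  atlas := {c | ∃ φ, ∃ hφ : IsSliceChart (range i) V φ, c = hφ.chart hi p hp}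
  chartAt m := (H m).choose_spec.1.chart hi p hp
  mem_chart_source m := (H m).choose_spec.2
  chart_mem_atlas m := ⟨_, (H m).choose_spec.1, rfl⟩

variable (H : ∀ m, ∃ φ, IsSliceChart (range i) V φ ∧ i m ∈ φ.source)

theorem isManifold : letI := chartedSpace hi p hp H; IsManifold 𝓘(ℝ, V) ω M := by
  let := chartedSpace hi p hp H
  refine isManifold_of_contDiffOn _ _ _ ?_
  rintro _ _ ⟨φ, hφ, rfl⟩ ⟨φ', hφ', rfl⟩
  refine (hφ.contDiffOn_chart_trans hi p hp hφ').mono ?_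
  rintro v ⟨hv, -⟩
  exact hv

theorem chart_mem_maximalAtlas (hφ : IsSliceChart (range i) V φ) :
    letI := chartedSpace hi p hp H
    hφ.chart hi p hp ∈ IsManifold.maximalAtlas 𝓘(ℝ, V) ω M := by
  let := chartedSpace hi p hp H
  have := isManifold hi p hp H
  exact IsManifold.subset_maximalAtlas ⟨φ, hφ, rfl⟩

/-- In a slice chart and the chart it induces, the inclusion is `v ↦ v`. A closed complement `F` of
`V` turns this into `v ↦ (v, 0)`. -/
theorem isAnalyticSubmanifoldStructure :
    IsAnalyticSubmanifoldStructure (chartedSpace hi p hp H) i := by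
  let := chartedSpace hi p hp H
  have hV : V.ClosedComplemented := ⟨p, hp⟩
  obtain ⟨F, e, he, he'⟩ := hV.exists_submodule_equiv_prod
  refine ⟨isManifold hi p hp H, ⟨F, inferInstance, inferInstance, fun m => ?_⟩, hi⟩
  obtain ⟨φ, hφ, hm⟩ := H m
  refine Manifold.IsImmersionAtOfComplement.mk_of_charts e.symm (hφ.chart hi p hp) φ hm hm
    (hφ.chart_mem_maximalAtlas hi p hp H) hφ.mem_maximalAtlas (fun _ h => h) ?_
  intro v hv
  have hv' : (v : E) ∈ φ.target := by simpa using! hv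
  change φ (i ((hφ.chart hi p hp).symm v)) = e.symm (v, 0)
  rw [hφ.map_chart_symm hi p hp hv', φ.right_inv hv', ← he v, e.symm_apply_apply]

/-- The local form `he` is stated through ambient points `i a = φ.symm v`, so that it can be checked
without the inverse of the induced chart. -/
theorem isSubmersionAtOfComplement {E' M' F : Type*} [NormedAddCommGroup E'] [NormedSpace ℝ E']
    [NormedAddCommGroup F] [NormedSpace ℝ F] {V' : Submodule ℝ E'} [TopologicalSpace M']
    [Nonempty M'] {i' : M' → E'} (hi' : IsEmbedding i') (p' : E' →L[ℝ] V') (hp' : ∀ v : V', p' v = v)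
    (H' : ∀ m, ∃ φ, IsSliceChart (range i') V' φ ∧ i' m ∈ φ.source)
    (hφ : IsSliceChart (range i) V φ) {ψ : OpenPartialHomeomorph E' E'}
    (hψ : IsSliceChart (range i') V' ψ) {g : M → M'} {m : M} (hg : ContinuousAt g m)
    (hm : i m ∈ φ.source) (hm' : i' (g m) ∈ ψ.source) (e : V ≃L[ℝ] V' × F)
    (he : ∀ v : V, (v : E) ∈ φ.target → ∀ a, i a = φ.symm v → ψ (i' (g a)) = ((e v).1 : E')) :
    letI := chartedSpace hi p hp H
    letI := chartedSpace hi' p' hp' H'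
    Manifold.IsSubmersionAtOfComplement F 𝓘(ℝ, V) 𝓘(ℝ, V') ω g m := by
  let := chartedSpace hi p hp H
  let := chartedSpace hi' p' hp' H'
  refine Manifold.IsSubmersionAtOfComplement.mk_of_continuousAt hg e (hφ.chart hi p hp)
    (hψ.chart hi' p' hp') hm hm' (hφ.chart_mem_maximalAtlas hi p hp H)
    (hψ.chart_mem_maximalAtlas hi' p' hp' H') fun v hv => ?_
  have hv' : (v : E) ∈ φ.target := by simpa using! hv
  change p' (ψ (i' (g ((hφ.chart hi p hp).symm v)))) = (e v).1
  rw [he v hv' _ (hφ.map_chart_symm hi p hp hv'), hp']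

/-- The symmetries `L` and `L'` bring `i m` and `i' (g m)` into two fixed charts, so an equivariant
map need only be computed at base points. -/
theorem isSubmersionAtOfComplement_comp_equiv {E' M' F : Type*} [NormedAddCommGroup E']
    [NormedSpace ℝ E'] [NormedAddCommGroup F] [NormedSpace ℝ F] {V' : Submodule ℝ E'}
    [TopologicalSpace M'] [Nonempty M'] {i' : M' → E'} (hi' : IsEmbedding i') (p' : E' →L[ℝ] V')
    (hp' : ∀ v : V', p' v = v) (H' : ∀ m, ∃ φ, IsSliceChart (range i') V' φ ∧ i' m ∈ φ.source)
    {ψ : OpenPartialHomeomorph E E} (hψ : IsSliceChart (range i) V ψ.symm)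
    {ψ' : OpenPartialHomeomorph E' E'} (hψ' : IsSliceChart (range i') V' ψ'.symm)
    (L : E ≃L[ℝ] E) (hL : ∀ y, L y ∈ range i ↔ y ∈ range i)
    (L' : E' ≃L[ℝ] E') (hL' : ∀ y, L' y ∈ range i' ↔ y ∈ range i')
    {g : M → M'} {m : M} (hg : ContinuousAt g m) (hm : L (i m) ∈ ψ.target)
    (hm' : L' (i' (g m)) ∈ ψ'.target) (e : V ≃L[ℝ] V' × F)
    (he : ∀ v : V, (v : E) ∈ ψ.source → ∀ a, L (i a) = ψ v →
      ψ'.symm (L' (i' (g a))) = ((e v).1 : E')) :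
    letI := chartedSpace hi p hp H
    letI := chartedSpace hi' p' hp' H'
    Manifold.IsSubmersionAtOfComplement F 𝓘(ℝ, V) 𝓘(ℝ, V') ω g m := by
  refine isSubmersionAtOfComplement hi p hp H hi' p' hp' H' (hψ.comp_equiv L hL)
    (hψ'.comp_equiv L' hL') hg hm hm' e fun v hv a ha => he v hv a ?_
  rw [ha]
  exact L.apply_symm_apply (ψ v)

omit [Nonempty M] [TopologicalSpace M] in
theorem isBanachSubmanifold (hV : ∀ x ∈ S, ∃ (V : Submodule ℝ E) (φ : OpenPartialHomeomorph E E),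
    V.ClosedComplemented ∧ IsSliceChart S V φ ∧ x ∈ φ.source) : IsBanachSubmanifold ω S := by
  intro x hx
  obtain ⟨V, φ, hV, hφ, hxφ⟩ := hV x hx
  exact ⟨V, φ, hV, hxφ, hφ.contDiffOn, hφ.contDiffOn_symm, hφ.mem_iff⟩

-- Along a curve in `S` the map `φ ∘ γ` is fixed by the projection `p` onto `V`, hence so is its
-- velocity; this velocity is `v` because `φ` has derivative `id` at `x`.
omit [Nonempty M] [TopologicalSpace M] in
theorem tangentSet_subset (hφ : IsSliceChart S V φ) {x : E} (hx : x ∈ φ.source)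
    (hd : HasFDerivAt φ (ContinuousLinearMap.id ℝ E) x) (hV : V.ClosedComplemented) :
    tangentSet S x ⊆ V := by
  rintro v ⟨γ, hγ, h0, hS, hv⟩
  obtain ⟨p, hp⟩ := hV
  subst h0
  have h1 : HasDerivAt (fun t => φ (γ t)) v 0 := by
    simpa using! hd.comp_hasDerivAt (0 : ℝ) hv
  have h2 : HasDerivAt (fun t => ((p (φ (γ t)) : V) : E)) (p v : V) 0 :=
    (V.subtypeL.comp p).hasFDerivAt.comp_hasDerivAt (0 : ℝ) h1
  have h3 : (fun t => ((p (φ (γ t)) : V) : E)) =ᶠ[𝓝 0] fun t => φ (γ t) := by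
    filter_upwards [hS, hγ.continuousAt.eventually (φ.open_source.mem_nhds hx)] with t ht ht'
    exact congrArg Subtype.val (hp ⟨_, (hφ.mem_iff _ ht').1 ht⟩)
  have h4 : v = (p v : V) := h1.unique (h2.congr_of_eventuallyEq h3.symm)
  rw [h4]
  exact (p v).2

end IsSliceChart

/-! ### The action on pairs and its derivative -/

namespace SphereBundle

variable {H : Type*} [NormedAddCommGroup H] [InnerProductSpace ℂ H]

theorem isBoundedBilinearMap_apply :
    IsBoundedBilinearMap ℝ (fun p : (H →L[ℂ] H) × H => p.1 p.2) where
  add_left _ _ _ := rfl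
  smul_left _ _ _ := rfl
  add_right T := map_add T
  smul_right c T x := T.map_smul_of_tower c x
  bound := ⟨1, one_pos, fun T x => by simpa using T.le_opNorm x⟩

/-- The action `(T, S) • (P, f) = (T P S, T f)`. -/
noncomputable def conjAct (T S : H →L[ℂ] H) (p : (H →L[ℂ] H) × H) : (H →L[ℂ] H) × H :=
  (T * p.1 * S, T p.2)

theorem conjAct_conjAct (T S T' S' : H →L[ℂ] H) (p : (H →L[ℂ] H) × H) :
    conjAct T S (conjAct T' S' p) = conjAct (T * T') (S' * S) p := by
  ext1
  · simp only [conjAct, mul_assoc]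
  · rfl

/-- The real linear map `X ↦ (X P - P X, X f)`. -/
noncomputable def orbitDeriv (p : (H →L[ℂ] H) × H) : (H →L[ℂ] H) →L[ℝ] (H →L[ℂ] H) × H where
  toFun X := (X * p.1 - p.1 * X, X p.2)
  map_add' X Y := by
    ext1
    · simp only [Prod.fst_add]; noncomm_ring
    · simp
  map_smul' c X := by
    ext1
    · simp [smul_sub]
    · simp
  cont := by
    refine .prodMk (by fun_prop) ?_
    exact (isBoundedBilinearMap_apply (H := H)).continuous.comp (.prodMk continuous_id
      continuous_const)

@[simp]
theorem orbitDeriv_apply (p : (H →L[ℂ] H) × H) (X : H →L[ℂ] H) :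
    orbitDeriv p X = (X * p.1 - p.1 * X, X p.2) := rfl

theorem hasFDerivAt_mul_mul_of_neg {F 𝔸 : Type*} [NormedAddCommGroup F] [NormedSpace ℝ F]
    [NormedRing 𝔸] [NormedAlgebra ℝ 𝔸] {u p w : F → 𝔸} {u' p' D : F →L[ℝ] 𝔸} {a : F}
    (hu : HasFDerivAt u u' a) (hw : HasFDerivAt w (-u') a) (hp : HasFDerivAt p p' a)
    (hu1 : u a = 1) (hw1 : w a = 1) (hD : ∀ v, D v = u' v * p a - p a * u' v + p' v) :
    HasFDerivAt (fun v => u v * p v * w v) D a := by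
  refine ((hu.mul' hp).mul' hw).congr_fderiv (ContinuousLinearMap.ext fun v => ?_)
  rw [hD]
  simp [hu1, hw1]
  abel

variable [CompleteSpace H]

theorem contDiff_exp : ContDiff ℝ ω (NormedSpace.exp : (H →L[ℂ] H) → H →L[ℂ] H) :=
  contDiff_iff_contDiffAt.2 fun x => (NormedSpace.exp_analytic (𝕂 := ℝ) x).contDiffAt

theorem exp_mem_unitary {X : H →L[ℂ] H} (hX : star X = -X) :
    NormedSpace.exp X ∈ unitary (H →L[ℂ] H) := by
  let : NormedAlgebra ℚ (H →L[ℂ] H) := NormedAlgebra.restrictScalars ℚ ℂ _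
  exact NormedSpace.exp_mem_unitary_of_mem_skewAdjoint (skewAdjoint.mem_iff.2 hX)

theorem star_exp_of_skew {X : H →L[ℂ] H} (hX : star X = -X) :
    star (NormedSpace.exp X) = NormedSpace.exp (-X) := by
  rw [NormedSpace.star_exp, hX]

theorem hasFDerivAt_exp_comp {F : Type*} [NormedAddCommGroup F] [NormedSpace ℝ F]
    (k : F →L[ℝ] H →L[ℂ] H) : HasFDerivAt (fun v => NormedSpace.exp (k v)) k 0 := by
  have h : HasFDerivAt (NormedSpace.exp : (H →L[ℂ] H) → H →L[ℂ] H)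
      (1 : (H →L[ℂ] H) →L[ℝ] H →L[ℂ] H) (k 0) := by
    rw [map_zero]
    exact hasFDerivAt_exp_zero
  exact h.comp (0 : F) k.hasFDerivAt

section

variable {F : Type*} [NormedAddCommGroup F] [NormedSpace ℝ F] (k : F →L[ℝ] H →L[ℂ] H)
  {x : F → (H →L[ℂ] H) × H}

theorem contDiff_conjAct_exp (hx : ContDiff ℝ ω x) :
    ContDiff ℝ ω fun v =>
      conjAct (NormedSpace.exp (k v)) (NormedSpace.exp (-k v)) (x v) := by
  have h1 : ContDiff ℝ ω fun v => NormedSpace.exp (k v) := contDiff_exp.comp k.contDiff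
  have h2 : ContDiff ℝ ω fun v => NormedSpace.exp (-k v) := contDiff_exp.comp k.contDiff.neg
  have h3 : ContDiff ℝ ω fun v => NormedSpace.exp (k v) (x v).2 :=
    (isBoundedBilinearMap_apply (H := H)).contDiff.comp (h1.prodMk hx.snd)
  exact ((h1.mul hx.fst).mul h2).prodMk h3

theorem hasFDerivAt_conjAct_exp {x' : F →L[ℝ] (H →L[ℂ] H) × H} (hx : HasFDerivAt x x' 0) :
    HasFDerivAt (fun v => conjAct (NormedSpace.exp (k v)) (NormedSpace.exp (-k v)) (x v))
      ((orbitDeriv (x 0)).comp k + x') 0 := by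
  have h1 : HasFDerivAt (fun v => NormedSpace.exp (k v)) k 0 := hasFDerivAt_exp_comp k
  have h2 : HasFDerivAt (fun v => NormedSpace.exp (-k v)) (-k) 0 := hasFDerivAt_exp_comp (-k)
  have h4 := ((ContinuousLinearMap.restrictScalarsL ℂ H H ℝ ℝ).hasFDerivAt.comp
    (0 : F) h1).clm_apply hx.snd
  have h0 : NormedSpace.exp (k 0) = 1 := by rw [map_zero, NormedSpace.exp_zero]
  have h0' : NormedSpace.exp (-k 0) = 1 := by rw [map_zero, neg_zero, NormedSpace.exp_zero]
  have h5 : HasFDerivAt (fun v => NormedSpace.exp (k v) * (x v).1 * NormedSpace.exp (-k v))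
      ((ContinuousLinearMap.fst ℝ _ _).comp ((orbitDeriv (x 0)).comp k + x')) 0 :=
    hasFDerivAt_mul_mul_of_neg h1 h2 hx.fst h0 h0' fun v => rfl
  have h6 : HasFDerivAt (fun v => NormedSpace.exp (k v) (x v).2)
      ((ContinuousLinearMap.snd ℝ _ _).comp ((orbitDeriv (x 0)).comp k + x')) 0 := by
    refine h4.congr_fderiv (ContinuousLinearMap.ext fun v => ?_)
    change NormedSpace.exp (k 0) (x' v).2 + k v (x 0).2 = k v (x 0).2 + (x' v).2
    rw [h0, add_comm]
    rfl
  exact h5.prodMk h6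

end

/-! ### The tangent projection -/

/-- A real linear right inverse of `orbitDeriv (P, f)` on the tangent space, with values in the
anti-Hermitian operators if the first component is Hermitian. -/
noncomputable def orbitLift (p : (H →L[ℂ] H) × H) : (H →L[ℂ] H) × H →L[ℝ] H →L[ℂ] H where
  toFun v := v.1 * p.1 - p.1 * v.1 + (InnerProductSpace.rankOne ℂ (p.1 v.2) p.2 -
    star (InnerProductSpace.rankOne ℂ (p.1 v.2) p.2)) -
    (Complex.I * ((inner ℂ p.2 v.2).im : ℂ)) • InnerProductSpace.rankOne ℂ p.2 p.2
  map_add' v w := by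
    simp only [Prod.fst_add, Prod.snd_add, map_add, add_apply, star_add,
      inner_add_right, Complex.add_im, Complex.ofReal_add, mul_add, add_mul, add_smul]
    abel
  map_smul' c v := by
    rw [show c • v = (c : ℂ) • v from rfl]
    change _ = (c : ℂ) • (_ : H →L[ℂ] H)
    have h : star ((c : ℂ) • InnerProductSpace.rankOne ℂ (p.1 v.2) p.2) =
        (c : ℂ) • star (InnerProductSpace.rankOne ℂ (p.1 v.2) p.2) := by
      rw [star_smul, Complex.star_def, Complex.conj_ofReal]
    simp only [Prod.smul_fst, Prod.smul_snd, smul_mul_assoc, mul_smul_comm, map_smul, h,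
      smul_apply, inner_smul_right, Complex.im_ofReal_mul, Complex.ofReal_mul, smul_sub, smul_add,
      smul_smul, mul_left_comm Complex.I]
  cont := by
    have h : Continuous fun v : (H →L[ℂ] H) × H => InnerProductSpace.rankOne ℂ (p.1 v.2) p.2 := by
      fun_prop
    fun_prop

theorem orbitLift_apply (p v : (H →L[ℂ] H) × H) :
    orbitLift p v = v.1 * p.1 - p.1 * v.1 + (InnerProductSpace.rankOne ℂ (p.1 v.2) p.2 -
    star (InnerProductSpace.rankOne ℂ (p.1 v.2) p.2)) -
    (Complex.I * ((inner ℂ p.2 v.2).im : ℂ)) • InnerProductSpace.rankOne ℂ p.2 p.2 := rfl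

theorem star_orbitLift {p v : (H →L[ℂ] H) × H} (hp : star p.1 = p.1) (hv : star v.1 = v.1) :
    star (orbitLift p v) = -orbitLift p v := by
  have h : star (InnerProductSpace.rankOne ℂ p.2 p.2) = InnerProductSpace.rankOne ℂ p.2 p.2 := by
    rw [ContinuousLinearMap.star_eq_adjoint, InnerProductSpace.adjoint_rankOne]
  rw [orbitLift_apply]
  simp only [star_add, star_sub, star_mul, star_star, star_smul, hp, hv, h]
  rw [show star ((inner ℂ p.2 v.2).im : ℂ) * star Complex.I =
    -(Complex.I * ((inner ℂ p.2 v.2).im : ℂ)) by simp [mul_comm], neg_smul]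
  abel

section

variable {P : H →L[ℂ] H} {f : H}

theorem apply_inner_right (h : (P, f) ∈ sphereBundle H) (x : H) :
    inner ℂ f (P x) = inner ℂ f x := by
  obtain ⟨⟨-, hs⟩, hf, -⟩ := h
  have hs' : ContinuousLinearMap.adjoint P = P := hs
  rw [← ContinuousLinearMap.adjoint_inner_left, hs', hf]

theorem inner_self_eq_one_of_mem (h : (P, f) ∈ sphereBundle H) : inner ℂ f f = 1 := by
  have hn : ‖f‖ = 1 := h.2.2
  rw [inner_self_eq_norm_sq_to_K, hn]; simp

/-- The commutator `XP - PX` produces the off-diagonal part of `X` and moves `f` by `P^⊥ X f`. The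
rank-one terms commute with `P`, so they affect only the vector component. With `z = inner ℂ f x`,
the difference of rank-one operators sends `f` to `P x - conj z • f = P x - z • f + 2i Im z • f`,
and the last term of `orbitLift` removes one of the two copies of `i Im z • f`. -/
theorem orbitDeriv_orbitLift (h : (P, f) ∈ sphereBundle H) (X : H →L[ℂ] H) (x : H) :
    orbitDeriv (P, f) (orbitLift (P, f) (X, x)) = tangentProjFormula P f X x := by
  have hi : P * P = P := h.1.1
  have hs : star P = P := h.1.2
  have hf : P f = f := h.2.1
  have hff := inner_self_eq_one_of_mem h
  have e1 : ∀ y, P * InnerProductSpace.rankOne ℂ (P x) y = InnerProductSpace.rankOne ℂ (P x) y := by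
    intro y
    ext z
    simp [← mul_apply_eq_comp, hi]
  have e2 : ∀ y, InnerProductSpace.rankOne ℂ y f * P = InnerProductSpace.rankOne ℂ y f := by
    intro y
    ext z
    simp [apply_inner_right h]
  have e3 : star (InnerProductSpace.rankOne ℂ (P x) f) * P =
      star (InnerProductSpace.rankOne ℂ (P x) f) := by
    have := congrArg star (e1 f)
    rwa [star_mul, hs] at this
  have e4 : P * star (InnerProductSpace.rankOne ℂ (P x) f) =
      star (InnerProductSpace.rankOne ℂ (P x) f) := by
    have := congrArg star (e2 (P x))
    rwa [star_mul, hs] at this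
  have e5 : P * InnerProductSpace.rankOne ℂ f f = InnerProductSpace.rankOne ℂ f f := by
    ext z
    simp [hf]
  ext1
  · simp only [orbitDeriv_apply, orbitLift_apply, tangentProjFormula, sub_mul, add_mul, mul_sub,
      mul_add, smul_mul_assoc, mul_smul_comm, e1, e2, e3, e4, e5]
    simp only [mul_assoc, hi, one_mul, mul_one, ← mul_assoc P P]
    abel
  · simp only [orbitDeriv_apply, orbitLift_apply, tangentProjFormula]
    have h1 : inner ℂ (P x) f = (starRingEnd ℂ) (inner ℂ f x) := by
      rw [← inner_conj_symm, apply_inner_right h]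
    have h2 : star (InnerProductSpace.rankOne ℂ (P x) f) f =
        (starRingEnd ℂ) (inner ℂ f x) • f := by
      rw [ContinuousLinearMap.star_eq_adjoint, InnerProductSpace.adjoint_rankOne,
        InnerProductSpace.rankOne_apply, h1]
    have h3 : (starRingEnd ℂ) (inner ℂ f x) =
        inner ℂ f x - 2 * (Complex.I * ((inner ℂ f x).im : ℂ)) := by
      generalize inner ℂ f x = z
      apply Complex.ext
      · simp
      · simp; ring
    simp only [add_apply, sub_apply, h2, h3,
      smul_apply, InnerProductSpace.rankOne_apply, hff, hf,
      mul_apply_eq_comp, one_apply_eq_self]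
    module

theorem mem_orbitTangent_iff {v : (H →L[ℂ] H) × H} :
    v ∈ orbitTangent P f ↔ ∃ X : H →L[ℂ] H, star X = -X ∧ orbitDeriv (P, f) X = v :=
  ⟨fun ⟨X, hX, h⟩ => ⟨X, hX, h.symm⟩, fun ⟨X, hX, h⟩ => ⟨X, hX, h.symm⟩⟩

theorem star_fst_of_mem_orbitTangent (h : (P, f) ∈ sphereBundle H) {v : (H →L[ℂ] H) × H}
    (hv : v ∈ orbitTangent P f) : star v.1 = v.1 := by
  obtain ⟨X, hX, rfl⟩ := mem_orbitTangent_iff.1 hv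
  have hs : star P = P := h.1.2
  simp only [orbitDeriv_apply, star_sub, star_mul, hs, hX]
  noncomm_ring

theorem inner_apply_self_of_skew {X : H →L[ℂ] H} (hX : star X = -X) (x : H) :
    inner ℂ x (X x) = Complex.I * ((inner ℂ x (X x)).im : ℂ) := by
  have h : (inner ℂ x (X x)).re = 0 := by
    have h1 : inner ℂ x (X x) = -(starRingEnd ℂ) (inner ℂ x (X x)) := by
      conv_lhs => rw [← ContinuousLinearMap.adjoint_inner_left,
        ← ContinuousLinearMap.star_eq_adjoint, hX]
      rw [inner_conj_symm, neg_apply, inner_neg_left]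
    generalize inner ℂ x (X x) = z at h1
    have h2 := congrArg Complex.re h1
    simp only [Complex.neg_re, Complex.conj_re] at h2
    linarith
  apply Complex.ext <;> simp [h]

/-- For anti-Hermitian `X` the number `inner ℂ f (X f)` is purely imaginary, so the two multiples of
`f` cancel and `P X f + P^⊥ X f` remains. -/
theorem tangentProjFormula_of_mem (h : (P, f) ∈ sphereBundle H) {v : (H →L[ℂ] H) × H}
    (hv : v ∈ orbitTangent P f) : tangentProjFormula P f v.1 v.2 = v := by
  obtain ⟨X, hX, rfl⟩ := mem_orbitTangent_iff.1 hv
  have hi : P * P = P := h.1.1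
  have hf : P f = f := h.2.1
  have h1 := inner_apply_self_of_skew hX f
  ext1
  · simp only [orbitDeriv_apply, tangentProjFormula, sub_mul, mul_sub, mul_assoc, hi, one_mul,
      mul_one, ← mul_assoc P P]
    abel
  · simp only [orbitDeriv_apply, tangentProjFormula, ← h1, sub_apply,
      mul_apply_eq_comp, one_apply_eq_self, hf, map_sub]
    rw [← mul_apply_eq_comp P P, hi]
    abel

end

variable (H) in
/-- The Hermitian part of an operator, as a continuous real linear map. -/
noncomputable def hermitianPart : (H →L[ℂ] H) →L[ℝ] H →L[ℂ] H :=
  (selfAdjoint.submodule ℝ (H →L[ℂ] H)).subtypeL.comp (selfAdjointPartL ℝ (H →L[ℂ] H))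

theorem star_hermitianPart (T : H →L[ℂ] H) : star (hermitianPart H T) = hermitianPart H T :=
  (selfAdjointPartL ℝ (H →L[ℂ] H) T).2

theorem hermitianPart_of_star_eq {T : H →L[ℂ] H} (hT : star T = T) : hermitianPart H T = T :=
  IsSelfAdjoint.coe_selfAdjointPart_apply ℝ hT

theorem hermitianPart_of_star_eq_neg {T : H →L[ℂ] H} (hT : star T = -T) :
    hermitianPart H T = 0 := by
  change ((selfAdjointPart ℝ T : selfAdjoint (H →L[ℂ] H)) : H →L[ℂ] H) = 0
  simp [hT]

/-- A right inverse of `orbitDeriv p` on its tangent space, with anti-Hermitian values. -/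
noncomputable def orbitSection (p : (H →L[ℂ] H) × H) : (H →L[ℂ] H) × H →L[ℝ] H →L[ℂ] H :=
  (orbitLift p).comp ((hermitianPart H).prodMap (ContinuousLinearMap.id ℝ H))

/-- The projection of `B(H) × H` onto the tangent space of the orbit of `p`. -/
noncomputable def tangentProj (p : (H →L[ℂ] H) × H) :
    (H →L[ℂ] H) × H →L[ℝ] (H →L[ℂ] H) × H :=
  (orbitDeriv p).comp (orbitSection p)

variable {P : H →L[ℂ] H} {f : H}

theorem star_orbitSection (h : (P, f) ∈ sphereBundle H) (v : (H →L[ℂ] H) × H) :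
    star (orbitSection (P, f) v) = -orbitSection (P, f) v :=
  star_orbitLift (p := (P, f)) (v := (hermitianPart H v.1, v.2)) h.1.2 (star_hermitianPart v.1)

theorem tangentProj_mem (h : (P, f) ∈ sphereBundle H) (v : (H →L[ℂ] H) × H) :
    tangentProj (P, f) v ∈ orbitTangent P f :=
  mem_orbitTangent_iff.2 ⟨_, star_orbitSection h v, rfl⟩

theorem tangentProj_of_star_eq (h : (P, f) ∈ sphereBundle H) {v : (H →L[ℂ] H) × H}
    (hv : star v.1 = v.1) : tangentProj (P, f) v = tangentProjFormula P f v.1 v.2 := by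
  rw [← orbitDeriv_orbitLift h v.1 v.2]
  change orbitDeriv (P, f) (orbitLift (P, f) (hermitianPart H v.1, v.2)) = _
  rw [hermitianPart_of_star_eq hv]

theorem tangentProj_of_mem (h : (P, f) ∈ sphereBundle H) {v : (H →L[ℂ] H) × H}
    (hv : v ∈ orbitTangent P f) : tangentProj (P, f) v = v := by
  rw [tangentProj_of_star_eq h (star_fst_of_mem_orbitTangent h hv), tangentProjFormula_of_mem h hv]

/-- The projection onto the tangent space, with values in the tangent space. -/
noncomputable def tangentProjL (h : (P, f) ∈ sphereBundle H) :
    (H →L[ℂ] H) × H →L[ℝ] orbitTangent P f :=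
  (tangentProj (P, f)).codRestrict _ (tangentProj_mem h)

theorem tangentProjL_coe (h : (P, f) ∈ sphereBundle H) (v : orbitTangent P f) :
    tangentProjL h v = v :=
  Subtype.ext (tangentProj_of_mem h v.2)

theorem closedComplemented_orbitTangent (h : (P, f) ∈ sphereBundle H) :
    (orbitTangent P f).ClosedComplemented :=
  ⟨tangentProjL h, tangentProjL_coe h⟩

/-! ### Transversality of the kernel of the projection -/

theorem eq_zero_of_mul_mul_self_eq {T : H →L[ℂ] H} (hT : T * T * T = T)
    (hn : ‖T‖ < 1) : T = 0 := by
  have h1 : ‖T‖ ≤ ‖T‖ * ‖T‖ * ‖T‖ := by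
    calc ‖T‖ = ‖T * T * T‖ := by rw [hT]
      _ ≤ ‖T * T‖ * ‖T‖ := norm_mul_le _ _
      _ ≤ _ := by gcongr; exact norm_mul_le _ _
  by_contra h
  have h2 : 0 < ‖T‖ := norm_pos_iff.2 h
  nlinarith [mul_pos h2 h2]

/-- A projection which is close to `P` and whose difference to `P` has no off-diagonal part
equals `P`. -/
theorem eq_zero_of_offDiagonal_eq_zero {P a : H →L[ℂ] H} (hi : P * P = P) (hs : star P = P)
    (ha : star a = a) (hi' : (P + a) * (P + a) = P + a)
    (h1 : (1 - P) * a * P + P * a * (1 - P) = 0) (hn : ‖a‖ < 1) : a = 0 := by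
  -- Multiplying by `1 - P` isolates one off-diagonal block; taking adjoints then shows that `a`
  -- commutes with `P`.
  have h3 : a * P = P * a * P := by
    have h4 : (1 - P) * ((1 - P) * a * P + P * a * (1 - P)) = a * P - P * a * P := by
      have : (1 - P) * P = 0 := by rw [sub_mul, hi, one_mul, sub_self]
      have h5 : (1 - P) * (1 - P) = 1 - P := by rw [mul_sub, this, mul_one, sub_zero]
      rw [mul_add, ← mul_assoc, ← mul_assoc, ← mul_assoc, h5, ← mul_assoc, this]
      noncomm_ring
    rw [h1, mul_zero] at h4
    exact (sub_eq_zero.1 h4.symm)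
  have h4 : P * a = a * P := by
    have := congrArg star h3
    simp only [star_mul, hs, ha, ← mul_assoc] at this
    exact this.trans h3.symm
  have h5 : a * a = a - (a * P + a * P) := by
    have : P + (a * P + a * P) + a * a = P + a := by
      rw [← hi']
      simp only [mul_add, add_mul, hi, h4]
      abel
    rw [add_assoc] at this
    rw [eq_sub_iff_add_eq, add_comm]
    exact add_left_cancel this
  -- Now `a` is a difference of commuting projections, so its spectrum lies in `{-1, 0, 1}`.
  -- Algebraically, `a² = a - 2aP` gives `a²P = -aP` and then `a³ = a`.
  have h6 : a * a * a = a := by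
    have h7 : a * a * P = a * P * P - (a * P * P + a * P * P) := by
      rw [h5, sub_mul, add_mul, mul_assoc a P P, hi]
    rw [mul_assoc a P P, hi] at h7
    have h8 : a * a * a = a * a - (a * a * P + a * a * P) := by
      rw [mul_assoc, h5, mul_sub, mul_add, ← mul_assoc a a P, h5]
    rw [h8, h7, h5]
    abel
  exact eq_zero_of_mul_mul_self_eq h6 hn

-- The equation `|1 + r| = 1` leaves `r = 0` or `r = -2`, and `|r| < 1` excludes the latter.
omit [CompleteSpace H] in
theorem eq_zero_of_norm_add_real_smul {f : H} (hff : ‖f‖ = 1) {r : ℝ}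
    (hn : ‖(r : ℂ) • f‖ < 1) (hn' : ‖f + (r : ℂ) • f‖ = 1) : r = 0 := by
  rw [norm_smul, hff, mul_one, Complex.norm_real, Real.norm_eq_abs, abs_lt] at hn
  rw [show f + (r : ℂ) • f = ((1 + r : ℝ) : ℂ) • f by push_cast; module, norm_smul, hff,
    mul_one, Complex.norm_real, Real.norm_eq_abs, abs_of_pos (by linarith)] at hn'
  linarith

/-- The kernel of `tangentProj` is transversal to the sphere bundle. -/
theorem eq_zero_of_tangentProj_eq_zero (h : (P, f) ∈ sphereBundle H) {c : (H →L[ℂ] H) × H}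
    (hc : tangentProj (P, f) c = 0) (hm : (P, f) + c ∈ sphereBundle H) (hn : ‖c‖ < 1) : c = 0 := by
  have hi : P * P = P := h.1.1
  have hs : star P = P := h.1.2
  have hf : P f = f := h.2.1
  have hi' : (P + c.1) * (P + c.1) = P + c.1 := hm.1.1
  have hs' : star (P + c.1) = P + c.1 := hm.1.2
  have hf' : (P + c.1) (f + c.2) = f + c.2 := hm.2.1
  have hn' : ‖f + c.2‖ = 1 := hm.2.2
  -- Membership in the bundle forces `c.1` to be Hermitian, and only then is `tangentProj` given by
  -- the explicit formula.
  have ha : star c.1 = c.1 := by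
    rw [star_add, hs] at hs'
    exact add_left_cancel hs'
  rw [tangentProj_of_star_eq h ha] at hc
  have h1 := congrArg Prod.fst hc
  have h2 := congrArg Prod.snd hc
  simp only [tangentProjFormula, Prod.fst_zero, Prod.snd_zero] at h1 h2
  have ha0 : c.1 = 0 :=
    eq_zero_of_offDiagonal_eq_zero hi hs ha hi' h1 ((norm_fst_le c).trans_lt hn)
  have hx1 : ‖c.2‖ < 1 := (norm_snd_le c).trans_lt hn
  rw [ha0, add_zero, map_add, hf] at hf'
  have hx : P c.2 = c.2 := add_left_cancel hf'
  rw [hx, ha0, zero_apply, map_zero, add_zero] at h2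
  refine Prod.ext ha0 ?_
  generalize c.2 = x at hn' h2 hx1
  -- The vector part of the formula vanishes only on real multiples of `f`, the directions normal to
  -- the unit sphere.
  have hx2 : x = ((inner ℂ f x).re : ℂ) • f := by
    have : x = (inner ℂ f x - Complex.I * ((inner ℂ f x).im : ℂ)) • f := by
      rw [← sub_eq_zero, ← h2]
      module
    rwa [show inner ℂ f x - Complex.I * ((inner ℂ f x).im : ℂ) = ((inner ℂ f x).re : ℂ) by
      apply Complex.ext <;> simp] at this
  rw [hx2] at hx1 hn'
  rw [hx2, eq_zero_of_norm_add_real_smul h.2.2 hx1 hn']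
  simp

/-! ### Slice charts of the sphere bundle and of the orbits -/

/-- Around the base point, `Φ` parametrizes `B(H) × H` in such a way that the sphere bundle
corresponds to the tangent space. -/
noncomputable def orbitParam (p v : (H →L[ℂ] H) × H) : (H →L[ℂ] H) × H :=
  conjAct (NormedSpace.exp (orbitSection p v)) (NormedSpace.exp (-orbitSection p v))
    (p + (v - tangentProj p v))

theorem contDiff_orbitParam (p : (H →L[ℂ] H) × H) : ContDiff ℝ ω (orbitParam p) :=
  contDiff_conjAct_exp _
    (contDiff_const.add (contDiff_id.sub (tangentProj p).contDiff))

/-- The exponential contributes `D s = π` and the affine part `1 - π`. -/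
theorem hasFDerivAt_orbitParam (p : (H →L[ℂ] H) × H) :
    HasFDerivAt (orbitParam p) (ContinuousLinearMap.id ℝ ((H →L[ℂ] H) × H)) 0 := by
  have hx : HasFDerivAt (fun v => p + (v - tangentProj p v))
      (ContinuousLinearMap.id ℝ ((H →L[ℂ] H) × H) - tangentProj p) 0 :=
    ((hasFDerivAt_id _).sub (tangentProj p).hasFDerivAt).const_add p
  refine (hasFDerivAt_conjAct_exp (orbitSection p) hx).congr_fderiv ?_
  rw [map_zero, sub_zero, add_zero]
  change tangentProj p + _ = _
  abel

theorem orbitParam_zero (p : (H →L[ℂ] H) × H) : orbitParam p 0 = p := by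
  simp [orbitParam, conjAct, NormedSpace.exp_zero]

/-- The action of a unitary operator on `B(H) × H`. -/
noncomputable def conjEquiv (U : unitary (H →L[ℂ] H)) :
    ((H →L[ℂ] H) × H) ≃L[ℝ] (H →L[ℂ] H) × H where
  toFun p := conjAct U (star (U : H →L[ℂ] H)) p
  invFun p := conjAct (star (U : H →L[ℂ] H)) U p
  map_add' p q := by
    ext1
    · simp only [conjAct, Prod.fst_add]; noncomm_ring
    · simp [conjAct]
  map_smul' c p := by
    ext1
    · simp [conjAct]
    · simp [conjAct]
  left_inv p := by
    change conjAct _ _ (conjAct _ _ p) = p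
    rw [conjAct_conjAct, (Unitary.mem_iff.1 U.2).1]
    simp [conjAct]
  right_inv p := by
    change conjAct _ _ (conjAct _ _ p) = p
    rw [conjAct_conjAct, (Unitary.mem_iff.1 U.2).2]
    simp [conjAct]
  continuous_toFun := by unfold conjAct; fun_prop
  continuous_invFun := by unfold conjAct; fun_prop

theorem conjEquiv_apply (U : unitary (H →L[ℂ] H)) (p : (H →L[ℂ] H) × H) :
    conjEquiv U p = conjAct U (star (U : H →L[ℂ] H)) p := rfl

theorem conjEquiv_mul (U V : unitary (H →L[ℂ] H)) (p : (H →L[ℂ] H) × H) :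
    conjEquiv U (conjEquiv V p) = conjEquiv (U * V) p := by
  simp [conjEquiv_apply, conjAct_conjAct]

theorem conjEquiv_one (p : (H →L[ℂ] H) × H) : conjEquiv (1 : unitary (H →L[ℂ] H)) p = p := by
  simp [conjEquiv_apply, conjAct]

theorem conjEquiv_mem (U : unitary (H →L[ℂ] H)) {p : (H →L[ℂ] H) × H} (hp : p ∈ sphereBundle H) :
    conjEquiv U p ∈ sphereBundle H :=
  (orbit_mem (P₀ := p.1) (f₀ := p.2) hp U).1

theorem conjEquiv_mem_iff (U : unitary (H →L[ℂ] H)) {p : (H →L[ℂ] H) × H} :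
    conjEquiv U p ∈ sphereBundle H ↔ p ∈ sphereBundle H := by
  refine ⟨fun h => ?_, conjEquiv_mem U⟩
  have := conjEquiv_mem U⁻¹ h
  rwa [conjEquiv_mul, inv_mul_cancel, conjEquiv_one] at this

theorem conjEquiv_mem_over (U : unitary (H →L[ℂ] H)) {P₀ : H →L[ℂ] H} {p : (H →L[ℂ] H) × H}
    (hp : p ∈ sphereBundleOver P₀) : conjEquiv U p ∈ sphereBundleOver P₀ := by
  obtain ⟨h, V, hV, hVp⟩ := hp
  refine ⟨conjEquiv_mem U h, U * V, mul_mem U.2 hV, ?_⟩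
  change _ = (U : H →L[ℂ] H) * p.1 * star (U : H →L[ℂ] H)
  rw [← hVp, star_mul]
  simp only [mul_assoc]

theorem conjEquiv_mem_over_iff (U : unitary (H →L[ℂ] H)) {P₀ : H →L[ℂ] H}
    {p : (H →L[ℂ] H) × H} :
    conjEquiv U p ∈ sphereBundleOver P₀ ↔ p ∈ sphereBundleOver P₀ := by
  refine ⟨fun h => ?_, conjEquiv_mem_over U⟩
  have := conjEquiv_mem_over U⁻¹ h
  rwa [conjEquiv_mul, inv_mul_cancel, conjEquiv_one] at this

/-- The unitary operator `exp X` of an anti-Hermitian operator `X`. -/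
noncomputable def unitaryExp (X : H →L[ℂ] H) (hX : star X = -X) : unitary (H →L[ℂ] H) :=
  ⟨NormedSpace.exp X, exp_mem_unitary hX⟩

theorem conjEquiv_unitaryExp {X : H →L[ℂ] H} (hX : star X = -X) (p : (H →L[ℂ] H) × H) :
    conjEquiv (unitaryExp X hX) p = conjAct (NormedSpace.exp X) (NormedSpace.exp (-X)) p := by
  rw [conjEquiv_apply, ← star_exp_of_skew hX]
  rfl

theorem base_mem_over (h : (P, f) ∈ sphereBundle H) : (P, f) ∈ sphereBundleOver P :=
  ⟨h, 1, one_mem _, by simp⟩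

theorem orbitParam_of_mem (h : (P, f) ∈ sphereBundle H) {v : (H →L[ℂ] H) × H}
    (hv : v ∈ orbitTangent P f) : orbitParam (P, f) v =
      conjEquiv (unitaryExp _ (star_orbitSection h v)) (P, f) := by
  rw [conjEquiv_unitaryExp, orbitParam, tangentProj_of_mem h hv, sub_self, add_zero]

theorem orbitParam_mem_over (h : (P, f) ∈ sphereBundle H) {v : (H →L[ℂ] H) × H}
    (hv : v ∈ orbitTangent P f) : orbitParam (P, f) v ∈ sphereBundleOver P := by
  rw [orbitParam_of_mem h hv]
  exact conjEquiv_mem_over _ (base_mem_over h)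

theorem mem_of_orbitParam_mem (h : (P, f) ∈ sphereBundle H) {v : (H →L[ℂ] H) × H}
    (hv : orbitParam (P, f) v ∈ sphereBundle H) (hn : ‖v - tangentProj (P, f) v‖ < 1) :
    v ∈ orbitTangent P f := by
  rw [orbitParam, ← conjEquiv_unitaryExp (star_orbitSection h v), conjEquiv_mem_iff] at hv
  have h0 : tangentProj (P, f) (v - tangentProj (P, f) v) = 0 := by
    rw [map_sub, tangentProj_of_mem h (tangentProj_mem h v), sub_self]
  have h1 := eq_zero_of_tangentProj_eq_zero h h0 hv hn
  rw [sub_eq_zero.1 h1]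
  exact tangentProj_mem h v

/-- Charts around a point of the sphere bundle which straighten the bundle and the orbit, and
whose inverse is `orbitParam`. -/
theorem exists_orbitParam_chart (h : (P, f) ∈ sphereBundle H) :
    ∃ ψ : OpenPartialHomeomorph ((H →L[ℂ] H) × H) ((H →L[ℂ] H) × H), 0 ∈ ψ.source ∧
      (∀ v, ψ v = orbitParam (P, f) v) ∧
      IsSliceChart (sphereBundle H) (orbitTangent P f) ψ.symm ∧
      IsSliceChart (sphereBundleOver P) (orbitTangent P f) ψ.symm := by
  have hN : {v : (H →L[ℂ] H) × H | ‖v - tangentProj (P, f) v‖ < 1} ∈ 𝓝 0 := by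
    refine IsOpen.mem_nhds (isOpen_lt (by fun_prop) continuous_const) ?_
    simp
  obtain ⟨ψ, h0, hsub, hψ, hc, hc'⟩ := exists_openPartialHomeomorph_of_hasFDerivAt_id
    (contDiff_orbitParam (P, f)).contDiffAt (hasFDerivAt_orbitParam (P, f)) hN
  -- Since `sphereBundleOver P` is contained in the bundle, these two implications close a cycle: on
  -- the chart domain both sets are the preimage of the tangent space.
  have key : ∀ y ∈ ψ.target, (y ∈ sphereBundle H → ψ.symm y ∈ orbitTangent P f) ∧
      (ψ.symm y ∈ orbitTangent P f → y ∈ sphereBundleOver P) := by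
    intro y hy
    have h1 : orbitParam (P, f) (ψ.symm y) = y := by rw [← hψ, ψ.right_inv hy]
    refine ⟨fun h2 => ?_, fun h2 => ?_⟩
    · exact mem_of_orbitParam_mem h (by rwa [h1]) (hsub (ψ.map_target hy))
    · rw [← h1]
      exact orbitParam_mem_over h h2
  exact ⟨ψ, h0, hψ, ⟨hc', hc, fun y hy => ⟨(key y hy).1, fun h' => ((key y hy).2 h').1⟩⟩,
    ⟨hc', hc, fun y hy => ⟨fun h' => (key y hy).1 h'.1, (key y hy).2⟩⟩⟩

/-! ### Slice charts of the unitary group -/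

variable (H) in
/-- The anti-Hermitian part of an operator, as a continuous real linear map. -/
noncomputable def skewPart : (H →L[ℂ] H) →L[ℝ] skewAdjoint.submodule ℝ (H →L[ℂ] H) :=
  (ContinuousLinearMap.id ℝ (H →L[ℂ] H) - hermitianPart H).codRestrict _ fun T => by
    have h := StarModule.selfAdjointPart_add_skewAdjointPart ℝ T
    have h' : T - hermitianPart H T = (skewAdjointPart ℝ T : H →L[ℂ] H) :=
      sub_eq_iff_eq_add'.2 h.symm
    change T - hermitianPart H T ∈ _
    rw [h']
    exact (skewAdjointPart ℝ T).2

theorem skewPart_coe (X : skewAdjoint.submodule ℝ (H →L[ℂ] H)) : skewPart H X = X := by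
  refine Subtype.ext ?_
  change (X : H →L[ℂ] H) - hermitianPart H X = X
  rw [hermitianPart_of_star_eq_neg (skewAdjoint.mem_iff.1 X.2), sub_zero]

theorem star_coe_skew (X : skewAdjoint.submodule ℝ (H →L[ℂ] H)) :
    star (X : H →L[ℂ] H) = -X := skewAdjoint.mem_iff.1 X.2

theorem hermitianPart_add_skewPart (T : H →L[ℂ] H) :
    hermitianPart H T + (skewPart H T : H →L[ℂ] H) = T :=
  add_sub_cancel _ _

/-- A parametrization of a neighbourhood of `1` for which the unitary operators correspond to the
anti-Hermitian ones, depending on a linear endomorphism `k` of the latter. -/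
noncomputable def unitaryParam (k : skewAdjoint.submodule ℝ (H →L[ℂ] H) →L[ℝ]
    skewAdjoint.submodule ℝ (H →L[ℂ] H)) (Z : H →L[ℂ] H) : H →L[ℂ] H :=
  NormedSpace.exp (k (skewPart H Z) : H →L[ℂ] H) *
    NormedSpace.exp ((skewPart H Z - k (skewPart H Z) : skewAdjoint.submodule ℝ (H →L[ℂ] H)) :
      H →L[ℂ] H) * (1 + hermitianPart H Z)

variable (k : skewAdjoint.submodule ℝ (H →L[ℂ] H) →L[ℝ] skewAdjoint.submodule ℝ (H →L[ℂ] H))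

theorem contDiff_unitaryParam : ContDiff ℝ ω (unitaryParam k) := by
  have h1 : ContDiff ℝ ω fun Z : H →L[ℂ] H =>
      NormedSpace.exp (k (skewPart H Z) : H →L[ℂ] H) :=
    contDiff_exp.comp ((Submodule.subtypeL _).comp (k.comp (skewPart H))).contDiff
  have h2 : ContDiff ℝ ω fun Z : H →L[ℂ] H => NormedSpace.exp
      ((skewPart H Z - k (skewPart H Z) : skewAdjoint.submodule ℝ (H →L[ℂ] H)) : H →L[ℂ] H) :=
    contDiff_exp.comp
      ((Submodule.subtypeL _).comp (skewPart H - k.comp (skewPart H))).contDiff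
  exact (h1.mul h2).mul (contDiff_const.add (hermitianPart H).contDiff)

omit [CompleteSpace H] in
theorem hasFDerivAt_mul_mul_of_eq_one {F 𝔸 : Type*} [NormedAddCommGroup F] [NormedSpace ℝ F]
    [NormedRing 𝔸] [NormedAlgebra ℝ 𝔸] {u p w : F → 𝔸} {u' p' w' D : F →L[ℝ] 𝔸} {a : F}
    (hu : HasFDerivAt u u' a) (hp : HasFDerivAt p p' a) (hw : HasFDerivAt w w' a)
    (hu1 : u a = 1) (hp1 : p a = 1) (hw1 : w a = 1) (hD : ∀ v, D v = u' v + p' v + w' v) :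
    HasFDerivAt (fun v => u v * p v * w v) D a := by
  refine ((hu.mul' hp).mul' hw).congr_fderiv (ContinuousLinearMap.ext fun v => ?_)
  rw [hD]
  simp [hu1, hw1, hp1]
  abel

/-- On the anti-Hermitian part the two exponentials contribute `k` and `1 - k`. The sum does not
depend on `k`, which leaves `k` free to be adapted to an orbit map. -/
theorem hasFDerivAt_unitaryParam :
    HasFDerivAt (unitaryParam k) (ContinuousLinearMap.id ℝ (H →L[ℂ] H)) 0 := by
  have h1 : HasFDerivAt (fun Z : H →L[ℂ] H => NormedSpace.exp (k (skewPart H Z) : H →L[ℂ] H))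
      ((Submodule.subtypeL _).comp (k.comp (skewPart H))) 0 :=
    hasFDerivAt_exp_comp ((Submodule.subtypeL _).comp (k.comp (skewPart H)))
  have h2 : HasFDerivAt (fun Z : H →L[ℂ] H => NormedSpace.exp
      ((skewPart H Z - k (skewPart H Z) : skewAdjoint.submodule ℝ (H →L[ℂ] H)) : H →L[ℂ] H))
      ((Submodule.subtypeL _).comp (skewPart H - k.comp (skewPart H))) 0 :=
    hasFDerivAt_exp_comp ((Submodule.subtypeL _).comp (skewPart H - k.comp (skewPart H)))
  have h3 : HasFDerivAt (fun Z : H →L[ℂ] H => 1 + hermitianPart H Z) (hermitianPart H) 0 :=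
    (hermitianPart H).hasFDerivAt.const_add 1
  refine hasFDerivAt_mul_mul_of_eq_one h1 h2 h3 ?_ ?_ ?_ fun Z => ?_
  · rw [map_zero, map_zero, Submodule.coe_zero, NormedSpace.exp_zero]
  · rw [map_zero, map_zero, sub_zero, Submodule.coe_zero, NormedSpace.exp_zero]
  · rw [map_zero, add_zero]
  · have h4 := hermitianPart_add_skewPart Z
    have h5 : ((skewPart H - k.comp (skewPart H)) Z : H →L[ℂ] H) =
      skewPart H Z - k (skewPart H Z) := rfl
    change Z = (k (skewPart H Z) : H →L[ℂ] H) + ((skewPart H - k.comp (skewPart H)) Z : H →L[ℂ] H) +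
      hermitianPart H Z
    rw [h5, add_sub_cancel, add_comm]
    exact h4.symm

theorem unitaryParam_zero : unitaryParam k 0 = 1 := by
  rw [unitaryParam, map_zero, map_zero, map_zero, sub_zero, Submodule.coe_zero,
    NormedSpace.exp_zero, mul_one, one_mul, add_zero]

theorem unitaryParam_coe (X : skewAdjoint.submodule ℝ (H →L[ℂ] H)) :
    unitaryParam k X = (unitaryExp (k X : H →L[ℂ] H) (star_coe_skew (k X)) : H →L[ℂ] H) *
      unitaryExp ((X - k X : skewAdjoint.submodule ℝ (H →L[ℂ] H)) : H →L[ℂ] H)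
        (star_coe_skew (X - k X)) := by
  rw [unitaryParam, skewPart_coe, hermitianPart_of_star_eq_neg (star_coe_skew X), add_zero, mul_one,
    unitaryExp, unitaryExp]

/-- Being Hermitian and unitary, `1 + Y` squares to `1`, so `2Y = -Y²` and `2‖Y‖ ≤ ‖Y‖²`. -/
theorem eq_zero_of_one_add_mem_unitary {Y : H →L[ℂ] H} (hY : star Y = Y)
    (hU : 1 + Y ∈ unitary (H →L[ℂ] H)) (hn : ‖Y‖ < 1) : Y = 0 := by
  have h1 : (1 + Y) * (1 + Y) = 1 := by
    have := (Unitary.mem_iff.1 hU).1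
    rwa [star_add, star_one, hY] at this
  have h2 : Y + Y = -(Y * Y) := by
    rw [eq_neg_iff_add_eq_zero]
    have h3 : (1 + Y) * (1 + Y) = 1 + (Y + Y + Y * Y) := by noncomm_ring
    rw [h3] at h1
    simpa using h1
  have h3 : ‖Y + Y‖ ≤ ‖Y‖ * ‖Y‖ := by
    rw [h2, norm_neg]
    exact norm_mul_le _ _
  have h4 : ‖Y + Y‖ = 2 * ‖Y‖ := by
    rw [← two_smul ℝ Y, norm_smul]
    simp
  by_contra h
  have h5 : 0 < ‖Y‖ := norm_pos_iff.2 h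
  nlinarith

theorem mem_skew_of_unitaryParam_mem {Z : H →L[ℂ] H} (hZ : unitaryParam k Z ∈ unitary (H →L[ℂ] H))
    (hn : ‖hermitianPart H Z‖ < 1) : Z ∈ skewAdjoint.submodule ℝ (H →L[ℂ] H) := by
  have h1 : NormedSpace.exp (k (skewPart H Z) : H →L[ℂ] H) *
      NormedSpace.exp ((skewPart H Z - k (skewPart H Z) : skewAdjoint.submodule ℝ (H →L[ℂ] H)) :
        H →L[ℂ] H) ∈ unitary (H →L[ℂ] H) :=
    mul_mem (exp_mem_unitary (star_coe_skew _)) (exp_mem_unitary (star_coe_skew _))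
  have h2 : 1 + hermitianPart H Z ∈ unitary (H →L[ℂ] H) := by
    have := mul_mem (Unitary.star_mem h1) hZ
    rwa [unitaryParam, ← mul_assoc, (Unitary.mem_iff.1 h1).1, one_mul] at this
  have h3 := eq_zero_of_one_add_mem_unitary (star_hermitianPart Z) h2 hn
  rw [← hermitianPart_add_skewPart Z, h3, zero_add]
  exact (skewPart H Z).2

/-- Slice charts of the unitary group at `1`, with inverse `unitaryParam k`. -/
theorem exists_unitaryParam_chart {N : Set (H →L[ℂ] H)} (hN : N ∈ 𝓝 0) :
    ∃ ψ : OpenPartialHomeomorph (H →L[ℂ] H) (H →L[ℂ] H), 0 ∈ ψ.source ∧ ψ.source ⊆ N ∧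
      (∀ v, ψ v = unitaryParam k v) ∧
      IsSliceChart (range (Subtype.val : unitary (H →L[ℂ] H) → H →L[ℂ] H))
        (skewAdjoint.submodule ℝ (H →L[ℂ] H)) ψ.symm := by
  have hN' : {Z : H →L[ℂ] H | ‖hermitianPart H Z‖ < 1} ∈ 𝓝 0 := by
    refine IsOpen.mem_nhds (isOpen_lt (by fun_prop) continuous_const) ?_
    simp
  obtain ⟨ψ, h0, hsub, hψ, hc, hc'⟩ := exists_openPartialHomeomorph_of_hasFDerivAt_id
    (contDiff_unitaryParam k).contDiffAt (hasFDerivAt_unitaryParam k) (Filter.inter_mem hN hN')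
  refine ⟨ψ, h0, fun x hx => (hsub hx).1, hψ, hc', hc, fun y hy => ?_⟩
  have h1 : unitaryParam k (ψ.symm y) = y := by rw [← hψ, ψ.right_inv hy]
  rw [Subtype.range_coe]
  refine ⟨fun h => ?_, fun h => ?_⟩
  · exact mem_skew_of_unitaryParam_mem k (by rw [h1]; exact h) (hsub (ψ.map_target hy)).2
  · rw [← h1, show ψ.symm y = ((⟨ψ.symm y, h⟩ : skewAdjoint.submodule ℝ (H →L[ℂ] H)) : H →L[ℂ] H)
      from rfl, unitaryParam_coe]
    exact mul_mem (Subtype.property _) (Subtype.property _)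

/-- Left multiplication by a unitary operator. -/
noncomputable def mulLeftEquiv (U : unitary (H →L[ℂ] H)) : (H →L[ℂ] H) ≃L[ℝ] H →L[ℂ] H where
  toFun T := U * T
  invFun T := star (U : H →L[ℂ] H) * T
  map_add' := mul_add _
  map_smul' c T := mul_smul_comm c _ T
  left_inv T := by
    change star (U : H →L[ℂ] H) * (U * T) = T
    rw [← mul_assoc, (Unitary.mem_iff.1 U.2).1, one_mul]
  right_inv T := by
    change (U : H →L[ℂ] H) * (star (U : H →L[ℂ] H) * T) = T
    rw [← mul_assoc, (Unitary.mem_iff.1 U.2).2, one_mul]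
  continuous_toFun := by fun_prop
  continuous_invFun := by fun_prop

theorem mem_range_unitary {T : H →L[ℂ] H} :
    T ∈ range (Subtype.val : unitary (H →L[ℂ] H) → H →L[ℂ] H) ↔ T ∈ unitary (H →L[ℂ] H) :=
  ⟨fun ⟨x, hx⟩ => hx ▸ x.2, fun h => ⟨⟨T, h⟩, rfl⟩⟩

theorem mulLeftEquiv_mem_iff (U : unitary (H →L[ℂ] H)) (T : H →L[ℂ] H) :
    mulLeftEquiv U T ∈ range (Subtype.val : unitary (H →L[ℂ] H) → H →L[ℂ] H) ↔
      T ∈ range (Subtype.val : unitary (H →L[ℂ] H) → H →L[ℂ] H) := by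
  rw [mem_range_unitary, mem_range_unitary]
  have h1 : ∀ V ∈ unitary (H →L[ℂ] H), V * T ∈ unitary (H →L[ℂ] H) →
      T ∈ unitary (H →L[ℂ] H) := fun V hV h => by
    have := mul_mem (Unitary.star_mem hV) h
    rwa [← mul_assoc, (Unitary.mem_iff.1 hV).1, one_mul] at this
  exact ⟨h1 U U.2, fun h : T ∈ unitary (H →L[ℂ] H) => mul_mem U.2 h⟩

theorem mulLeftEquiv_inv_self (U : unitary (H →L[ℂ] H)) : mulLeftEquiv U⁻¹ U = 1 :=
  (Unitary.mem_iff.1 U.2).1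

theorem exists_slice_unitary (U : unitary (H →L[ℂ] H)) :
    ∃ φ, IsSliceChart (range (Subtype.val : unitary (H →L[ℂ] H) → H →L[ℂ] H))
      (skewAdjoint.submodule ℝ (H →L[ℂ] H)) φ ∧ (U : H →L[ℂ] H) ∈ φ.source := by
  -- Any `k` would do: the atlas consists of all slice charts and so contains those for every other
  -- `k`.
  obtain ⟨ψ, h0, -, hψ, hs⟩ := exists_unitaryParam_chart (0 : _ →L[ℝ] _)
    (Filter.univ_mem (f := 𝓝 (0 : H →L[ℂ] H)))
  refine ⟨_, hs.comp_equiv (mulLeftEquiv U⁻¹) (mulLeftEquiv_mem_iff U⁻¹), ?_⟩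
  change (mulLeftEquiv U⁻¹ U : H →L[ℂ] H) ∈ ψ.target
  rw [mulLeftEquiv_inv_self, ← unitaryParam_zero (0 : _ →L[ℝ] _), ← hψ]
  exact ψ.map_source h0

variable (H) in
/-- The analytic structure of the unitary group. -/
@[reducible]
noncomputable def unitaryChartedSpace :
    ChartedSpace (skewAdjoint.submodule ℝ (H →L[ℂ] H)) (unitary (H →L[ℂ] H)) :=
  IsSliceChart.chartedSpace .subtypeVal (skewPart H) skewPart_coe exists_slice_unitary

/-! ### Transitivity of the action and the charts of an orbit -/

variable {P : H →L[ℂ] H} {f : H}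

open InnerProductSpace in
/-- A unitary operator which commutes with `P` and maps a given unit vector in the range of `P` to
another one. -/
theorem exists_unitary_commute_apply_eq (hs : star P = P) {g : H} (hf : P f = f) (hg : P g = g)
    (hfn : ‖f‖ = 1) (hgn : ‖g‖ = 1) :
    ∃ W ∈ unitary (H →L[ℂ] H), W * P = P * W ∧ W f = g := by
  by_cases hfg : f = g
  · exact ⟨1, one_mem _, by simp, by simpa⟩
  have hw : f - g ≠ 0 := sub_ne_zero.2 hfg
  -- The operator is the complex reflection `W = 1 - a⁻¹ (w ⊗ w)` with `a = inner ℂ w f`. It sends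
  -- `f` to `f - w = g`, commutes with `P` because `P w = w`, and is unitary because `a + conj a =
  -- ‖w‖²`, which also gives `a ≠ 0`.
  set w := f - g with hwdef
  have hPw : P w = w := by rw [hwdef, map_sub, hf, hg]
  set R := rankOne ℂ w w with hR
  set a : ℂ := inner ℂ w f with ha
  have hRs : star R = R := by
    rw [ContinuousLinearMap.star_eq_adjoint, hR, adjoint_rankOne]
  have hRR : R * R = (inner ℂ w w : ℂ) • R := by
    ext z
    simp [hR, smul_smul, mul_comm]
  have haa : a + (starRingEnd ℂ) a = inner ℂ w w := by
    have h1 : inner ℂ f f = (1 : ℂ) := by rw [inner_self_eq_norm_sq_to_K, hfn]; simp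
    have h2 : inner ℂ g g = (1 : ℂ) := by rw [inner_self_eq_norm_sq_to_K, hgn]; simp
    rw [ha, inner_conj_symm, hwdef]
    simp only [inner_sub_left, inner_sub_right, h1, h2]
    ring
  have hww : inner ℂ w w ≠ (0 : ℂ) := inner_self_ne_zero.2 hw
  have ha0 : a ≠ 0 := by
    intro h
    rw [h, map_zero, add_zero] at haa
    exact hww haa.symm
  have ha0' : (starRingEnd ℂ) a ≠ 0 := by simpa using ha0
  have hWs : star (1 - a⁻¹ • R) = 1 - ((starRingEnd ℂ) a)⁻¹ • R := by
    rw [star_sub, star_one, star_smul, hRs, star_inv₀]; rfl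
  have key : ∀ b c : ℂ, b ≠ 0 → c ≠ 0 → b + c = inner ℂ w w →
      (1 - b⁻¹ • R) * (1 - c⁻¹ • R) = 1 := by
    intro b c hb hc hbc
    have h1 : (1 - b⁻¹ • R) * (1 - c⁻¹ • R) = 1 - b⁻¹ • R - c⁻¹ • R + (b⁻¹ * c⁻¹) • (R * R) := by
      simp only [mul_sub, sub_mul, one_mul, mul_one, smul_mul_assoc, mul_smul_comm]
      module
    have h2 : b⁻¹ * c⁻¹ * (b + c) = b⁻¹ + c⁻¹ := by field_simp; ring
    rw [h1, hRR, ← hbc, smul_smul, h2, add_smul]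
    abel
  refine ⟨1 - a⁻¹ • R, ?_, ?_, ?_⟩
  · rw [Unitary.mem_iff, hWs]
    exact ⟨key _ _ ha0' ha0 (by rw [add_comm, haa]), key _ _ ha0 ha0' haa⟩
  · have h1 : R * P = R := by
      ext z
      simp only [mul_apply_eq_comp, hR, rankOne_apply]
      rw [← ContinuousLinearMap.adjoint_inner_left, ← ContinuousLinearMap.star_eq_adjoint, hs, hPw]
    have h2 : P * R = R := by
      ext z
      simp [hR, hPw]
    rw [sub_mul, mul_sub, smul_mul_assoc, mul_smul_comm, h1, h2, one_mul, mul_one]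
  · simp only [sub_apply, one_apply_eq_self, smul_apply, hR, rankOne_apply, smul_smul]
    rw [inv_mul_cancel₀ ha0, one_smul, hwdef, sub_sub_cancel]

/-- A unitary `V` with `V P V* = q.1` pulls `q` back to a pair over `P`; a unitary commuting with
`P` then matches the vectors. -/
theorem exists_conjEquiv_eq (h : (P, f) ∈ sphereBundle H) {q : (H →L[ℂ] H) × H}
    (hq : q ∈ sphereBundleOver P) : ∃ U : unitary (H →L[ℂ] H), conjEquiv U (P, f) = q := by
  obtain ⟨hq, V, hV, hVP⟩ := hq
  have hV1 : star V * V = 1 := (Unitary.mem_iff.1 hV).1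
  have hV2 : V * star V = 1 := (Unitary.mem_iff.1 hV).2
  have hm := conjEquiv_mem (⟨V, hV⟩⁻¹ : unitary (H →L[ℂ] H)) hq
  have hm1 : (conjEquiv (⟨V, hV⟩⁻¹ : unitary (H →L[ℂ] H)) q).1 = P := by
    change star V * q.1 * star (star V) = P
    rw [← hVP, star_star, mul_assoc, mul_assoc _ _ V, hV1, mul_one, ← mul_assoc, hV1, one_mul]
  obtain ⟨-, hm2, hm3⟩ := hm
  rw [hm1] at hm2
  obtain ⟨W, hW, hWP, hWf⟩ := exists_unitary_commute_apply_eq h.1.2 h.2.1 hm2 h.2.2 hm3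
  have hW' : conjEquiv ⟨W, hW⟩ (P, f) = conjEquiv (⟨V, hV⟩⁻¹ : unitary (H →L[ℂ] H)) q := by
    refine Prod.ext ?_ hWf
    rw [hm1]
    change W * P * star W = P
    rw [hWP, mul_assoc, (Unitary.mem_iff.1 hW).2, mul_one]
  refine ⟨⟨V, hV⟩ * ⟨W, hW⟩, ?_⟩
  rw [← conjEquiv_mul, hW', conjEquiv_mul, mul_inv_cancel, conjEquiv_one]

theorem exists_slice_over (h : (P, f) ∈ sphereBundle H) (q : sphereBundleOver P) :
    ∃ φ, IsSliceChart (range (Subtype.val : sphereBundleOver P → (H →L[ℂ] H) × H))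
      (orbitTangent P f) φ ∧ (q : (H →L[ℂ] H) × H) ∈ φ.source := by
  obtain ⟨ψ, h0, hψ, -, hs⟩ := exists_orbitParam_chart h
  obtain ⟨U, hU⟩ := exists_conjEquiv_eq h q.2
  rw [Subtype.range_coe]
  refine ⟨_, hs.comp_equiv (conjEquiv U⁻¹) fun y => conjEquiv_mem_over_iff U⁻¹, ?_⟩
  change conjEquiv U⁻¹ q ∈ ψ.target
  have : conjEquiv U⁻¹ q = ψ 0 := by
    rw [hψ, orbitParam_zero, ← hU, conjEquiv_mul, inv_mul_cancel, conjEquiv_one]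
  rw [this]
  exact ψ.map_source h0

theorem nonempty_over (h : (P, f) ∈ sphereBundle H) : Nonempty (sphereBundleOver P) :=
  ⟨⟨_, base_mem_over h⟩⟩

/-- The analytic structure of the orbit of `(P, f)`. -/
@[reducible]
noncomputable def orbitChartedSpace (h : (P, f) ∈ sphereBundle H) :
    ChartedSpace (orbitTangent P f) (sphereBundleOver P) :=
  have := nonempty_over h
  IsSliceChart.chartedSpace .subtypeVal (tangentProjL h) (tangentProjL_coe h) (exists_slice_over h)

/-! ### The orbit map is a submersion -/

theorem conjEquiv_unitaryExp_of_orbitDeriv_eq_zero (h : (P, f) ∈ sphereBundle H) {Y : H →L[ℂ] H}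
    (hY : star Y = -Y) (h0 : orbitDeriv (P, f) Y = 0) :
    conjEquiv (unitaryExp Y hY) (P, f) = (P, f) := by
  let : NormedAlgebra ℚ (H →L[ℂ] H) := NormedAlgebra.restrictScalars ℚ ℂ _
  have h1 : Y * P = P * Y := sub_eq_zero.1 (congrArg Prod.fst h0)
  have h2 : Y f = 0 := congrArg Prod.snd h0
  have h3 : SemiconjBy P Y Y := h1.symm
  -- Encoding `Y f = 0` as an intertwining of `0` with `Y` gives `exp Y f = f` from the
  -- functoriality of `exp`, without expanding the series.
  have h4 : SemiconjBy (InnerProductSpace.rankOne ℂ f f) 0 Y := by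
    change _ * 0 = Y * _
    ext z
    simp [h2]
  have h5 : P * NormedSpace.exp Y = NormedSpace.exp Y * P := h3.exp_right
  have h6 : InnerProductSpace.rankOne ℂ f f * NormedSpace.exp 0 =
    NormedSpace.exp Y * InnerProductSpace.rankOne ℂ f f := h4.exp_right
  refine Prod.ext ?_ ?_
  · change NormedSpace.exp Y * P * star (NormedSpace.exp Y) = P
    rw [← h5, mul_assoc, (Unitary.mem_iff.1 (exp_mem_unitary hY)).2, mul_one]
  · change NormedSpace.exp Y f = f
    have h7 := congrArg (fun T : H →L[ℂ] H => T f) h6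
    simp only [NormedSpace.exp_zero, mul_one, mul_apply_eq_comp, InnerProductSpace.rankOne_apply,
      inner_self_eq_one_of_mem h, one_smul] at h7
    exact h7.symm

/-- The derivative of the orbit map at `1`, as a map onto the tangent space. -/
noncomputable def orbitDerivL (p : (H →L[ℂ] H) × H) :
    skewAdjoint.submodule ℝ (H →L[ℂ] H) →L[ℝ] orbitTangent p.1 p.2 :=
  ((orbitDeriv p).comp (Submodule.subtypeL _)).codRestrict _ fun X =>
    mem_orbitTangent_iff.2 ⟨X, star_coe_skew X, rfl⟩

/-- A right inverse of `orbitDerivL`. -/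
noncomputable def orbitSectionL (h : (P, f) ∈ sphereBundle H) :
    orbitTangent P f →L[ℝ] skewAdjoint.submodule ℝ (H →L[ℂ] H) :=
  ((orbitSection (P, f)).comp (Submodule.subtypeL _)).codRestrict _ fun v =>
    skewAdjoint.mem_iff.2 (star_orbitSection h v)

theorem orbitDerivL_orbitSectionL (h : (P, f) ∈ sphereBundle H) (v : orbitTangent P f) :
    orbitDerivL (P, f) (orbitSectionL h v) = v :=
  Subtype.ext (tangentProj_of_mem h v.2)

/-- In the coordinates `unitaryParam` and `orbitParam` the orbit map is `orbitDeriv`. -/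
theorem conjEquiv_exp_mul_exp (h : (P, f) ∈ sphereBundle H)
    (X : skewAdjoint.submodule ℝ (H →L[ℂ] H)) :
    conjEquiv (unitaryExp _ (star_coe_skew (orbitSectionL h (orbitDerivL (P, f) X))) *
      unitaryExp _ (star_coe_skew (X - orbitSectionL h (orbitDerivL (P, f) X)))) (P, f) =
    orbitParam (P, f) (orbitDerivL (P, f) X) := by
  rw [orbitParam_of_mem h (orbitDerivL (P, f) X).2, ← conjEquiv_mul,
    conjEquiv_unitaryExp_of_orbitDeriv_eq_zero h]
  · rfl
  · have h1 : orbitDerivL (P, f) (X - orbitSectionL h (orbitDerivL (P, f) X)) = 0 := by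
      rw [map_sub, orbitDerivL_orbitSectionL, sub_self]
    exact congrArg Subtype.val h1

theorem continuous_orbitMap (h : (P, f) ∈ sphereBundle H) : Continuous (orbitMap h) := by
  have h1 : Continuous fun U : unitary (H →L[ℂ] H) => (U : H →L[ℂ] H) := continuous_subtype_val
  exact (((h1.mul continuous_const).mul h1.star).prodMk
    (h1.clm_apply continuous_const)).subtype_mk _

theorem conjEquiv_eq_of_eq_unitaryParam (h : (P, f) ∈ sphereBundle H)
    {U : unitary (H →L[ℂ] H)} {X : skewAdjoint.submodule ℝ (H →L[ℂ] H)}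
    (hU : (U : H →L[ℂ] H) =
      unitaryParam ((orbitSectionL h).comp (orbitDerivL (P, f))) X) :
    conjEquiv U (P, f) = orbitParam (P, f) (orbitDerivL (P, f) X) := by
  rw [← conjEquiv_exp_mul_exp h X]
  congr 1
  refine congrArg conjEquiv (Subtype.ext ?_)
  rw [hU, unitaryParam_coe]
  rfl

theorem coe_orbitMap (h : (P, f) ∈ sphereBundle H) (U : unitary (H →L[ℂ] H)) :
    (orbitMap h U : (H →L[ℂ] H) × H) = conjEquiv U (P, f) := rfl

theorem conjEquiv_orbitMap_eq_orbitParam (h : (P, f) ∈ sphereBundle H)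
    {U W : unitary (H →L[ℂ] H)} {X : skewAdjoint.submodule ℝ (H →L[ℂ] H)}
    (hW : mulLeftEquiv U⁻¹ W = unitaryParam ((orbitSectionL h).comp (orbitDerivL (P, f))) X) :
    conjEquiv U⁻¹ (orbitMap h W : (H →L[ℂ] H) × H) =
      orbitParam (P, f) (orbitDerivL (P, f) X) := by
  rw [coe_orbitMap, conjEquiv_mul]
  exact conjEquiv_eq_of_eq_unitaryParam h hW

theorem preimage_orbitDerivL_mem_nhds (p : (H →L[ℂ] H) × H) {s : Set ((H →L[ℂ] H) × H)}
    (hs : IsOpen s) (h0 : 0 ∈ s) :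
    {Z : H →L[ℂ] H | (orbitDerivL p (skewPart H Z) : (H →L[ℂ] H) × H) ∈ s} ∈ 𝓝 0 := by
  let T := (Submodule.subtypeL _).comp ((orbitDerivL p).comp (skewPart H))
  exact T.continuous.continuousAt.preimage_mem_nhds (hs.mem_nhds (by rwa [map_zero T]))

theorem isSubmersion_orbitMap (h : (P, f) ∈ sphereBundle H) :
    letI := unitaryChartedSpace H
    letI := orbitChartedSpace h
    Manifold.IsSubmersion 𝓘(ℝ, skewAdjoint.submodule ℝ (H →L[ℂ] H))
      𝓘(ℝ, orbitTangent P f) ω (orbitMap h) := by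
  have := nonempty_over h
  -- A continuous right inverse splits the anti-Hermitian operators as the tangent space times the
  -- kernel of `orbitDerivL`, which is the complement required of a submersion.
  have hinv : Function.RightInverse (orbitSectionL h) (orbitDerivL (P, f)) :=
    orbitDerivL_orbitSectionL h
  refine ⟨(orbitDerivL (P, f)).ker, inferInstance, inferInstance, fun U => ?_⟩
  obtain ⟨ψ', h0', hψ', -, hs'⟩ := exists_orbitParam_chart h
  obtain ⟨ψ, h0, hsub, hψ, hs⟩ :=
    exists_unitaryParam_chart ((orbitSectionL h).comp (orbitDerivL (P, f)))
      -- The chart at `1` is shrunk so that `D X` stays in the source of `ψ'`, where `ψ'.symm`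
      -- inverts `orbitParam`.
      (preimage_orbitDerivL_mem_nhds (P, f) ψ'.open_source h0')
  rw [← Subtype.range_coe (s := sphereBundleOver P)] at hs'
  refine IsSliceChart.isSubmersionAtOfComplement_comp_equiv (V' := orbitTangent P f)
    .subtypeVal (skewPart H) skewPart_coe exists_slice_unitary .subtypeVal (tangentProjL h)
    (tangentProjL_coe h) (exists_slice_over h) hs hs' (mulLeftEquiv U⁻¹) (mulLeftEquiv_mem_iff U⁻¹) (conjEquiv U⁻¹)
    (fun y => by rw [Subtype.range_coe]; exact conjEquiv_mem_over_iff U⁻¹)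
    (continuous_orbitMap h).continuousAt ?_ ?_
    (ContinuousLinearEquiv.equivOfRightInverse (orbitDerivL (P, f)) (orbitSectionL h) hinv)
    fun X hX W hW => ?_
  · rw [mulLeftEquiv_inv_self, ← unitaryParam_zero, ← hψ]
    exact ψ.map_source h0
  · rw [coe_orbitMap, conjEquiv_mul, inv_mul_cancel, conjEquiv_one, ← orbitParam_zero (P, f), ← hψ']
    exact ψ'.map_source h0'
  · have hX2 := hsub hX
    rw [Set.mem_ofPred_eq, skewPart_coe] at hX2
    have hW' := conjEquiv_orbitMap_eq_orbitParam h (hW.trans (hψ X))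
    rw [hW', ← hψ']
    exact ψ'.left_inv hX2

/-! ### Tangent spaces and the projection on Hermitian pairs -/

theorem orbitTangent_subset_tangentSet (h : (P, f) ∈ sphereBundle H) :
    (orbitTangent P f : Set ((H →L[ℂ] H) × H)) ⊆ tangentSet (sphereBundleOver P) (P, f) := by
  intro v hv
  obtain ⟨X, hX, rfl⟩ := mem_orbitTangent_iff.1 hv
  let k : ℝ →L[ℝ] H →L[ℂ] H := ContinuousLinearMap.toSpanSingleton ℝ X
  have hk : ∀ t : ℝ, star (k t) = -k t := fun t => by
    simp [k, hX]
  -- The velocity `D X` is realized by the one-parameter orbit `t ↦ exp(tX) · (P, f)`.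
  refine ⟨fun t => conjAct (NormedSpace.exp (k t)) (NormedSpace.exp (-k t)) (P, f), ?_, ?_, ?_, ?_⟩
  · exact ((contDiff_conjAct_exp k contDiff_const).of_le le_top).contDiffAt
  · simp [conjAct, NormedSpace.exp_zero]
  · refine Filter.Eventually.of_forall fun t => ?_
    beta_reduce
    rw [← conjEquiv_unitaryExp (hk t)]
    exact conjEquiv_mem_over _ (base_mem_over h)
  · have := (hasFDerivAt_conjAct_exp k (hasFDerivAt_const (P, f) (0 : ℝ))).hasDerivAt
    simpa [k] using! this

theorem tangentSet_mono {E : Type*} [NormedAddCommGroup E] [NormedSpace ℝ E] {S T : Set E}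
    (hST : S ⊆ T) (x : E) : tangentSet S x ⊆ tangentSet T x :=
  fun _ ⟨γ, h1, h2, h3, h4⟩ => ⟨γ, h1, h2, h3.mono fun _ h => hST h, h4⟩

theorem tangentSet_subset_orbitTangent (h : (P, f) ∈ sphereBundle H) :
    tangentSet (sphereBundle H) (P, f) ⊆ orbitTangent P f := by
  obtain ⟨ψ, h0, hψ, hs, -⟩ := exists_orbitParam_chart h
  have h1 : ψ 0 = (P, f) := by rw [hψ, orbitParam_zero]
  have hp : (P, f) ∈ ψ.target := h1 ▸ ψ.map_source h0
  have h2 : ψ.symm (P, f) = 0 := by rw [← h1, ψ.left_inv h0]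
  refine hs.tangentSet_subset hp ?_ (closedComplemented_orbitTangent h)
  refine ψ.hasFDerivAt_symm (f' := ContinuousLinearEquiv.refl ℝ _) hp ?_
  rw [h2, show (ψ : (H →L[ℂ] H) × H → (H →L[ℂ] H) × H) = orbitParam (P, f) from funext hψ]
  exact hasFDerivAt_orbitParam (P, f)

/-- The projection `𝓔` of `B_h(H) × H` onto the tangent space. -/
noncomputable def hermitianTangentProj (h : (P, f) ∈ sphereBundle H) :
    (selfAdjoint.submodule ℝ (H →L[ℂ] H)) × H →L[ℝ]
      (selfAdjoint.submodule ℝ (H →L[ℂ] H)) × H :=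
  let 𝓔 := (tangentProj (P, f)).comp
    ((Submodule.subtypeL (selfAdjoint.submodule ℝ (H →L[ℂ] H))).prodMap
      (ContinuousLinearMap.id ℝ H))
  (((ContinuousLinearMap.fst ℝ _ _).comp 𝓔).codRestrict _ fun _ =>
    star_fst_of_mem_orbitTangent h (tangentProj_mem h _)).prod
    ((ContinuousLinearMap.snd ℝ _ _).comp 𝓔)

theorem coe_hermitianTangentProj (h : (P, f) ∈ sphereBundle H)
    (p : (selfAdjoint.submodule ℝ (H →L[ℂ] H)) × H) :
    (((hermitianTangentProj h p).1 : H →L[ℂ] H), (hermitianTangentProj h p).2) =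
      tangentProj (P, f) ((p.1 : H →L[ℂ] H), p.2) := rfl

end SphereBundle

open SphereBundle

theorem mainTheorem5 {H : Type*} [NormedAddCommGroup H] [InnerProductSpace ℂ H]
    [CompleteSpace H] :
    IsBanachSubmanifold ω (sphereBundle H) ∧
    ∃ cU : ChartedSpace (skewAdjoint.submodule ℝ (H →L[ℂ] H)) (unitary (H →L[ℂ] H)),
      IsAnalyticSubmanifoldStructure cU
        (Subtype.val : unitary (H →L[ℂ] H) → (H →L[ℂ] H)) ∧
      ∀ (P₀ : H →L[ℂ] H) (f₀ : H) (h₀ : (P₀, f₀) ∈ sphereBundle H),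
        (∃ cR : ChartedSpace (orbitTangent P₀ f₀) (sphereBundleOver P₀),
          IsAnalyticSubmanifoldStructure cR
            (Subtype.val : sphereBundleOver P₀ → (H →L[ℂ] H) × H) ∧
          Manifold.IsSubmersion 𝓘(ℝ, skewAdjoint.submodule ℝ (H →L[ℂ] H))
            𝓘(ℝ, orbitTangent P₀ f₀) ω (orbitMap h₀)) ∧
        tangentSet (sphereBundle H) (P₀, f₀) = orbitTangent P₀ f₀ ∧
        tangentSet (sphereBundleOver P₀) (P₀, f₀) = orbitTangent P₀ f₀ ∧
        (orbitTangent P₀ f₀).ClosedComplemented ∧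
        ∃ 𝓔 : (selfAdjoint.submodule ℝ (H →L[ℂ] H)) × H →L[ℝ]
            (selfAdjoint.submodule ℝ (H →L[ℂ] H)) × H,
          (∀ p, (((𝓔 p).1 : H →L[ℂ] H), (𝓔 p).2) =
            tangentProjFormula P₀ f₀ (p.1 : H →L[ℂ] H) p.2) ∧
          (∀ p, 𝓔 (𝓔 p) = 𝓔 p) ∧
          Set.range (fun p => (((𝓔 p).1 : H →L[ℂ] H), (𝓔 p).2)) = orbitTangent P₀ f₀ := by
  refine ⟨IsSliceChart.isBanachSubmanifold fun q hq => ?_, unitaryChartedSpace H,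
    IsSliceChart.isAnalyticSubmanifoldStructure _ _ _ _, fun P₀ f₀ h => ⟨⟨orbitChartedSpace h, ?_,
      isSubmersion_orbitMap h⟩, ?_, ?_, closedComplemented_orbitTangent h,
      hermitianTangentProj h, ?_, ?_, ?_⟩⟩
  · obtain ⟨ψ, h0, hψ, hs, -⟩ := exists_orbitParam_chart (P := q.1) (f := q.2) hq
    refine ⟨_, _, closedComplemented_orbitTangent hq, hs, ?_⟩
    have h1 : ψ 0 = q := by rw [hψ, orbitParam_zero]
    exact h1 ▸ ψ.map_source h0
  · have := nonempty_over h
    exact IsSliceChart.isAnalyticSubmanifoldStructure _ _ _ _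
  -- Both equalities come from the cycle: `orbitTangent`, tangents to the orbit, tangents to the
  -- bundle, `orbitTangent`.
  · exact (tangentSet_subset_orbitTangent h).antisymm ((orbitTangent_subset_tangentSet h).trans
      (tangentSet_mono (fun _ hx => hx.1) _))
  · exact ((tangentSet_mono (fun _ hx => hx.1) _).trans (tangentSet_subset_orbitTangent h)).antisymm
      (orbitTangent_subset_tangentSet h)
  · intro p
    rw [coe_hermitianTangentProj]
    exact tangentProj_of_star_eq h p.1.2
  · intro p
    have h1 : tangentProj (P₀, f₀) (tangentProj (P₀, f₀) ((p.1 : H →L[ℂ] H), p.2)) =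
        tangentProj (P₀, f₀) ((p.1 : H →L[ℂ] H), p.2) :=
      tangentProj_of_mem h (tangentProj_mem h _)
    exact Prod.ext (Subtype.ext (congrArg Prod.fst h1 :)) (congrArg Prod.snd h1 :)
  · refine Set.Subset.antisymm ?_ fun v hv => ?_
    · rintro _ ⟨p, rfl⟩
      exact tangentProj_mem h _
    · exact ⟨(⟨v.1, star_fst_of_mem_orbitTangent h hv⟩, v.2), tangentProj_of_mem h hv⟩
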